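/- Consider a leader (agent $0$) and followers $1,\dots,N$ with identical dynamics $\dot x_i=Ax_i+Bu_i$, $y_i=Cx_i$, where $x_i\in\mathbb R^n$, $u_i\in\mathbb R^p$, $y_i\in\mathbb R^q$, $(A,B)$ is stabilizable, $(A,C)$ is detectable, and $u_0=0$. The communication digraph has adjacency weights $a_{ij}\ge 0$ ($a_{ij}>0$ iff agent $i$ receives information from agent $j$; $0$--$1$ weights are a special case). The leader receives no information ($a_{0j}=0$), and there is a directed path from the leader to every follower (directed spanning tree rooted at the leader); it is not required that $a_{i0}>0$ for all followers $i$, so only some of them need have access to the leader. Let $K_1\in\mathbb R^{p\times n}$ and let $h_1,\dots,h_N:[0,\infty)\to\mathbb R^n$ satisfy $\dot h_i=(A+BK_1)h_i$ except at finitely many times, at which $h_i$ may jump. Each follower $i=1,\dots,N$ knows its own output $y_i$ and uses the protocol $$\begin{aligned} u_i&=K_1h_i+K_2v_i,\\ \dot w_i&=Aw_i+Bu_i-BK_1h_i+F[Cw_i-(y_i-Ch_i)],\\ \dot v_i&=Av_i+Bu_i-BK_1h_i+(c_i+\rho_i)FC\varrho_i+F[Cw_i-(y_i-Ch_i)],\\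 \dot c_i&=\varrho_i^TC^T\Gamma C\varrho_i, \end{aligned}$$ where $\varrho_i=\psi_i-\eta_i$, $\psi_i=\sum_{j=0}^Na_{ij}(v_i-v_j)$, $\eta_i=\sum_{j=0}^Na_{ij}(w_i-w_j)$, and for the leader $\dot w_0=Aw_0+F(Cw_0-y_0)$ and $v_0=0$. Suppose that $A+BK_2$ is Hurwitz, $\Gamma=I$, $F=-Q^{-1}C^T$ and $\rho_i=\varrho_i^TQ\varrho_i$, where $Q$ is a symmetric positive definite matrix with $QA+A^TQ-2C^TC<0$ (negative definite). Then for all initial values $x_i(0),w_i(0)\in\mathbb R^n$ ($0\le i\le N$), $v_i(0)\in\mathbb R^n$ and $c_i(0)\ge 0$ ($1\le i\le N$), the closed-loop system has a solution on $[0,\infty)$ (continuous functions that satisfy the differential equations except at the jump times of the $h_i$), and for every such solution $$\lim_{t\to\infty}\|y_i(t)-y_0(t)-Ch_i(t)\|=0,\qquad i=1,\dots,N,$$ and each coupling weight $c_i(t)$ converges to a finite value as $t\to\infty$. -/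

import Mathlib

open scoped Matrix

namespace FormationTracking

/-- A real square matrix is Hurwitz if all its complex eigenvalues have negative real part. -/
def IsHurwitz {n : ℕ} (M : Matrix (Fin n) (Fin n) ℝ) : Prop :=
  ∀ z ∈ spectrum ℂ (M.map (algebraMap ℝ ℂ)), z.re < 0

def IsStabilizable {n p : ℕ} (A : Matrix (Fin n) (Fin n) ℝ) (B : Matrix (Fin n) (Fin p) ℝ) :
    Prop :=
  ∃ K : Matrix (Fin p) (Fin n) ℝ, IsHurwitz (A + B * K)

def IsDetectable {n q : ℕ} (A : Matrix (Fin n) (Fin n) ℝ) (C : Matrix (Fin q) (Fin n) ℝ) :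
    Prop :=
  ∃ L : Matrix (Fin n) (Fin q) ℝ, IsHurwitz (A + L * C)

/-- The adjacency matrix of a weighted digraph on the agents `0, …, N`: the weight `a i j` is
positive when agent `i` receives information from agent `j`, and zero otherwise.
The leader `0` receives no information. -/
structure IsLeaderFollowerAdjacency {N : ℕ} (a : Matrix (Fin (N + 1)) (Fin (N + 1)) ℝ) :
    Prop where
  nonneg : ∀ i j, 0 ≤ a i j
  leader : ∀ j, a 0 j = 0

/-- From the leader there is a directed path to every agent. -/
def HasSpanningTreeRootedAtLeader {N : ℕ} (a : Matrix (Fin (N + 1)) (Fin (N + 1)) ℝ) : Prop :=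
  ∀ i, Relation.ReflTransGen (fun j k => 0 < a k j) 0 i

/-- The time-varying formation shape: each `h i` satisfies `h' = (A + B K₁) h` on `[0, ∞)` except
at the finitely many times in `S`, where it may switch (jump). -/
def IsFormationShape {N n p : ℕ} (A : Matrix (Fin n) (Fin n) ℝ) (B : Matrix (Fin n) (Fin p) ℝ)
    (K₁ : Matrix (Fin p) (Fin n) ℝ) (S : Finset ℝ) (h : Fin N → ℝ → Fin n → ℝ) : Prop :=
  ∀ i : Fin N, ∀ t : ℝ, 0 ≤ t → t ∉ S →
    HasDerivWithinAt (h i) ((A + B * K₁) *ᵥ h i t) (Set.Ici 0) t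

/-- All signals of the closed loop. Agent `0` is the leader, and agent `i.succ` is the follower
with index `i : Fin N`. -/
structure Signals (N n : ℕ) where
  /-- the agents' states -/
  x : Fin (N + 1) → ℝ → Fin n → ℝ
  /-- the local observers -/
  w : Fin (N + 1) → ℝ → Fin n → ℝ
  /-- the distributed observers -/
  v : Fin (N + 1) → ℝ → Fin n → ℝ
  /-- the followers' coupling weights -/
  c : Fin N → ℝ → ℝ

/-- The measured output `y = C x` of an agent. -/
def Signals.y {N n q : ℕ} (s : Signals N n) (C : Matrix (Fin q) (Fin n) ℝ)
    (i : Fin (N + 1)) (t : ℝ) : Fin q → ℝ :=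
  C *ᵥ s.x i t

/-- `ψ_i = ∑_{j = 0}^N a_{ij} (v_i - v_j)`. -/
def Signals.ψ {N n : ℕ} (s : Signals N n) (a : Matrix (Fin (N + 1)) (Fin (N + 1)) ℝ)
    (i : Fin N) (t : ℝ) : Fin n → ℝ :=
  ∑ j, a i.succ j • (s.v i.succ t - s.v j t)

/-- `η_i = ∑_{j = 0}^N a_{ij} (w_i - w_j)`. -/
def Signals.η {N n : ℕ} (s : Signals N n) (a : Matrix (Fin (N + 1)) (Fin (N + 1)) ℝ)
    (i : Fin N) (t : ℝ) : Fin n → ℝ :=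
  ∑ j, a i.succ j • (s.w i.succ t - s.w j t)

/-- `ϱ_i = ψ_i - η_i`. -/
def Signals.varrho {N n : ℕ} (s : Signals N n) (a : Matrix (Fin (N + 1)) (Fin (N + 1)) ℝ)
    (i : Fin N) (t : ℝ) : Fin n → ℝ :=
  s.ψ a i t - s.η a i t

/-- The control input `u_i = K₁ h_i + K₂ v_i` of a follower. -/
def Signals.u {N n p : ℕ} (s : Signals N n) (K₁ K₂ : Matrix (Fin p) (Fin n) ℝ)
    (h : Fin N → ℝ → Fin n → ℝ) (i : Fin N) (t : ℝ) : Fin p → ℝ :=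
  K₁ *ᵥ h i t + K₂ *ᵥ s.v i.succ t

/-- The signals are a solution on `[0, ∞)` of the agents' dynamics (the leader without input) in
closed loop with the two-observer adaptive protocol with gains `K₁, K₂, F, Γ` and
`ρ_i = ρ (ϱ_i)`: they are continuous on `[0, ∞)` and satisfy the differential equations at all
times outside the set `S` of switching times of `h`. -/
structure IsClosedLoopSolution {N n p q : ℕ}
    (A : Matrix (Fin n) (Fin n) ℝ) (B : Matrix (Fin n) (Fin p) ℝ) (C : Matrix (Fin q) (Fin n) ℝ)
    (a : Matrix (Fin (N + 1)) (Fin (N + 1)) ℝ)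
    (K₁ K₂ : Matrix (Fin p) (Fin n) ℝ) (F : Matrix (Fin n) (Fin q) ℝ)
    (Γ : Matrix (Fin q) (Fin q) ℝ) (ρ : (Fin n → ℝ) → ℝ)
    (S : Finset ℝ) (h : Fin N → ℝ → Fin n → ℝ) (s : Signals N n) : Prop where
  x_cont : ∀ i, ContinuousOn (s.x i) (Set.Ici 0)
  w_cont : ∀ i, ContinuousOn (s.w i) (Set.Ici 0)
  v_cont : ∀ i, ContinuousOn (s.v i) (Set.Ici 0)
  c_cont : ∀ i, ContinuousOn (s.c i) (Set.Ici 0)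
  leader_x : ∀ t : ℝ, 0 ≤ t → t ∉ S →
    HasDerivWithinAt (s.x 0) (A *ᵥ s.x 0 t) (Set.Ici 0) t
  leader_w : ∀ t : ℝ, 0 ≤ t → t ∉ S →
    HasDerivWithinAt (s.w 0) (A *ᵥ s.w 0 t + F *ᵥ (C *ᵥ s.w 0 t - s.y C 0 t)) (Set.Ici 0) t
  leader_v : ∀ t : ℝ, 0 ≤ t → s.v 0 t = 0
  follower_x : ∀ i : Fin N, ∀ t : ℝ, 0 ≤ t → t ∉ S →
    HasDerivWithinAt (s.x i.succ) (A *ᵥ s.x i.succ t + B *ᵥ s.u K₁ K₂ h i t) (Set.Ici 0) t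
  follower_w : ∀ i : Fin N, ∀ t : ℝ, 0 ≤ t → t ∉ S →
    HasDerivWithinAt (s.w i.succ)
      (A *ᵥ s.w i.succ t + B *ᵥ s.u K₁ K₂ h i t - (B * K₁) *ᵥ h i t
        + F *ᵥ (C *ᵥ s.w i.succ t - (s.y C i.succ t - C *ᵥ h i t))) (Set.Ici 0) t
  follower_v : ∀ i : Fin N, ∀ t : ℝ, 0 ≤ t → t ∉ S →
    HasDerivWithinAt (s.v i.succ)
      (A *ᵥ s.v i.succ t + B *ᵥ s.u K₁ K₂ h i t - (B * K₁) *ᵥ h i t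
        + (s.c i t + ρ (s.varrho a i t)) • ((F * C) *ᵥ s.varrho a i t)
        + F *ᵥ (C *ᵥ s.w i.succ t - (s.y C i.succ t - C *ᵥ h i t))) (Set.Ici 0) t
  follower_c : ∀ i : Fin N, ∀ t : ℝ, 0 ≤ t → t ∉ S →
    HasDerivWithinAt (s.c i)
      (s.varrho a i t ⬝ᵥ ((Cᵀ * Γ * C) *ᵥ s.varrho a i t)) (Set.Ici 0) t

/-- The signals start at the given initial values (the leader has no distributed observer). -/
def Signals.StartsAt {N n : ℕ} (s : Signals N n) (xInit wInit : Fin (N + 1) → Fin n → ℝ)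
    (vInit : Fin N → Fin n → ℝ) (cInit : Fin N → ℝ) : Prop :=
  (∀ i, s.x i 0 = xInit i) ∧ (∀ i, s.w i 0 = wInit i) ∧
    (∀ i : Fin N, s.v i.succ 0 = vInit i) ∧ ∀ i, s.c i 0 = cInit i

/-- Output formation tracking: `‖y_i(t) - y_0(t) - C h_i(t)‖ → 0` (Euclidean norm) for every
follower. -/
def Signals.AchievesOutputTracking {N n q : ℕ} (s : Signals N n) (C : Matrix (Fin q) (Fin n) ℝ)
    (h : Fin N → ℝ → Fin n → ℝ) : Prop :=
  ∀ i : Fin N, Filter.Tendsto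
    (fun t : ℝ => ‖WithLp.toLp 2 (s.y C i.succ t - s.y C 0 t - C *ᵥ h i t)‖)
    Filter.atTop (nhds 0)

end FormationTracking

/-!
The formation shape disappears from the observer errors. The local observer errors
`e₀ = w₀ - x₀` and `e_i = w_i - (x_i - h_i)` solve `e' = (A + F C) e` between switching times, and
decay by the linear matrix inequality, with energy `eᵀ Q e`. The differences
`δ_i = v_i - w_i + w₀` satisfy `δ_i' = A δ_i + (c_i + ρ_i) F C ϱ_i + F C e₀`, where `ϱ = L δ` and
`L` is the Laplacian of the followers. Together with `e₀` and the coupling weights they form an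
autonomous system (`observerField`) that does not see `h`.

The spanning tree makes `L` a nonsingular M-matrix, so there are weights `g_i > 0` for which,
with `G = diag(g_i)`, `G L + Lᵀ G` is positive definite (`exists_weights_followerLaplacian`). With
them the function
`∑ g_i (c_i ρ_i + ρ_i² / 2) + ½ ∑ (c_i - α_i)² + κ e₀ᵀ Q e₀` decreases along the observer error
system (`exists_dissipation`). Thus `ϱ` and `c` stay bounded, and the monotone weights `c_i`
converge. The same inequality, without the terms in `α_i`, bounds the derivative of the first sum
by a negative multiple of that sum plus the derivative of a convergent function,
which forces `ϱ → 0` and hence `δ → 0` (`observer_errors_converge`).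

The deviation `ξ_i = x_i - h_i - x₀` satisfies `ξ_i' = (A + B K₂) ξ_i + B K₂ (δ_i + e_i - e₀)` after
the last switching time. A Hurwitz system with vanishing input converges to zero
(`tendsto_zero_of_isHurwitz`), and `C ξ_i` is the tracking error.

For existence, the autonomous system is multiplied by a cutoff function, which makes it complete
without affecting the decrease of the Lyapunov function; the sublevel sets of that function are
bounded, so the solution never reaches the region where the cutoff acts
(`exists_observer_solution`). The remaining signals solve linear systems whose inputs are
continuous except for finitely many jumps, and are given by variation of constants.
-/

namespace FormationTracking

open Filter Topology Set

/-! ### Scalar differential inequalities -/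

/-- Asymptotic decay without integrals: the input is the derivative of a convergent function `R`,
so `y - R` is eventually antitone and bounded below. Hence `y` converges, and a positive limit
would force `y - R` to decrease linearly. -/
theorem tendsto_zero_of_deriv_le_neg_mul_add_deriv {y y' R R' : ℝ → ℝ} {ε l : ℝ} (hε : 0 < ε)
    (hy : ∀ᶠ t in atTop, 0 ≤ y t) (hy' : ∀ᶠ t in atTop, HasDerivAt y (y' t) t)
    (hR' : ∀ᶠ t in atTop, HasDerivAt R (R' t) t)
    (hle : ∀ᶠ t in atTop, y' t ≤ -ε * y t + R' t) (hR : Tendsto R atTop (𝓝 l)) :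
    Tendsto y atTop (𝓝 0) := by
  have hRb : ∀ᶠ t in atTop, R t < l + 1 := hR.eventually_lt_const (by linarith)
  obtain ⟨T, hT⟩ := eventually_atTop.1 (hy.and (hy'.and (hR'.and (hle.and hRb))))
  have hanti : AntitoneOn (fun t => y t - R t) (Ici T) := by
    refine antitoneOn_of_hasDerivWithinAt_nonpos (f' := fun t => y' t - R' t) (convex_Ici T)
      (fun t ht => ((hT t ht).2.1.sub (hT t ht).2.2.1).continuousAt.continuousWithinAt)
      (fun t ht => ?_) (fun t ht => ?_)
    · have ht := interior_subset ht
      exact ((hT t ht).2.1.sub (hT t ht).2.2.1).hasDerivWithinAt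
    · have ht := interior_subset ht
      have := (hT t ht).2.2.2.1
      have := mul_nonneg hε.le (hT t ht).1
      linarith
  have hanti' : Antitone (fun t => y (max t T) - R (max t T)) := fun s t hst =>
    hanti (mem_Ici.2 (le_max_right _ _)) (mem_Ici.2 (le_max_right _ _)) (max_le_max_right T hst)
  have hbdd : BddBelow (range fun t => y (max t T) - R (max t T)) := by
    refine ⟨-(l + 1), ?_⟩
    rintro _ ⟨t, rfl⟩
    have h := hT (max t T) (le_max_right _ _)
    have := h.1
    have := h.2.2.2.2
    simp only
    linarith
  have hm := tendsto_atTop_ciInf hanti' hbdd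
  set m := ⨅ t, (y (max t T) - R (max t T))
  have hm' : Tendsto (fun t => y t - R t) atTop (𝓝 m) := by
    refine hm.congr' ?_
    filter_upwards [eventually_ge_atTop T] with t ht
    rw [max_eq_left ht]
  have hylim : Tendsto y atTop (𝓝 (m + l)) := by
    refine (hm'.add hR).congr fun t => by ring
  have hnn : 0 ≤ m + l := ge_of_tendsto hylim hy
  rcases hnn.eq_or_lt with h0 | hpos
  · rwa [← h0] at hylim
  exfalso
  set k := ε * ((m + l) / 2) with hk
  have hkpos : 0 < k := by positivity
  have hyk : ∀ᶠ t in atTop, (m + l) / 2 < y t := hylim.eventually_const_lt (by linarith)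
  obtain ⟨T', hT'⟩ := eventually_atTop.1 (hyk.and (eventually_ge_atTop T))
  have hanti2 : AntitoneOn (fun t => y t - R t + k * t) (Ici T') := by
    have hd : ∀ t ∈ Ici T', HasDerivAt (fun t => y t - R t + k * t) (y' t - R' t + k) t :=
      fun t ht => by
        have h := hT t (hT' t ht).2
        have hk : HasDerivAt (fun t => k * t) k t := by simpa using (hasDerivAt_id t).const_mul k
        exact (h.2.1.sub h.2.2.1).add hk
    refine antitoneOn_of_hasDerivWithinAt_nonpos (f' := fun t => y' t - R' t + k) (convex_Ici T')
      (fun t ht => (hd t ht).continuousAt.continuousWithinAt)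
      (fun t ht => (hd t (interior_subset ht)).hasDerivWithinAt) (fun t ht => ?_)
    have ht := interior_subset ht
    have h1 := (hT t (hT' t ht).2).2.2.2.1
    have h2 := mul_lt_mul_of_pos_left (hT' t ht).1 hε
    linarith
  have hinf : Tendsto (fun t => y t - R t + k * t) atTop atTop :=
    hm'.add_atTop (tendsto_id.const_mul_atTop hkpos)
  obtain ⟨t, ht1, ht2⟩ := ((hinf.eventually_gt_atTop (y T' - R T' + k * T')).and
    (eventually_ge_atTop T')).exists
  exact absurd (hanti2 self_mem_Ici ht2 ht2) (not_le.2 ht1)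

/-- The counterpart of `tendsto_zero_of_deriv_le_neg_mul_add_deriv` for an input that tends to zero
but need not be integrable. -/
theorem tendsto_zero_of_deriv_le_neg_mul_add {y y' r : ℝ → ℝ} {ε : ℝ} (hε : 0 < ε)
    (hy : ∀ᶠ t in atTop, 0 ≤ y t) (hy' : ∀ᶠ t in atTop, HasDerivAt y (y' t) t)
    (hle : ∀ᶠ t in atTop, y' t ≤ -ε * y t + r t) (hr : Tendsto r atTop (𝓝 0)) :
    Tendsto y atTop (𝓝 0) := by
  refine tendsto_order.2 ⟨fun a ha => hy.mono fun t ht => ha.trans_le ht, fun δ hδ => ?_⟩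
  have hrb : ∀ᶠ t in atTop, r t < ε * (δ / 2) := hr.eventually_lt_const (by positivity)
  obtain ⟨T, hT⟩ := eventually_atTop.1 (hy'.and (hle.and hrb))
  -- With `r ≤ ε δ / 2`, the function `exp (ε t) (y - δ / 2)` is antitone.
  have hd : ∀ t ∈ Ici T, HasDerivAt (fun t => Real.exp (ε * t) * (y t - δ / 2))
      (Real.exp (ε * t) * ε * (y t - δ / 2) + Real.exp (ε * t) * y' t) t := fun t ht => by
    have h1 : HasDerivAt (fun t => Real.exp (ε * t)) (Real.exp (ε * t) * ε) t := by
      simpa using ((hasDerivAt_id t).const_mul ε).exp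
    exact h1.mul ((hT t ht).1.sub_const _)
  have hanti : AntitoneOn (fun t => Real.exp (ε * t) * (y t - δ / 2)) (Ici T) := by
    refine antitoneOn_of_hasDerivWithinAt_nonpos (convex_Ici T)
      (fun t ht => (hd t ht).continuousAt.continuousWithinAt)
      (fun t ht => (hd t (interior_subset ht)).hasDerivWithinAt) (fun t ht => ?_)
    have ht := interior_subset ht
    have h1 := (hT t ht).2.1
    have h2 := (hT t ht).2.2
    have : Real.exp (ε * t) * ε * (y t - δ / 2) + Real.exp (ε * t) * y' t
        = Real.exp (ε * t) * (ε * (y t - δ / 2) + y' t) := by ring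
    rw [this]
    exact mul_nonpos_of_nonneg_of_nonpos (Real.exp_pos _).le (by linarith)
  have hexp : Tendsto (fun t => Real.exp (ε * t) * (δ / 2)) atTop atTop :=
    (Real.tendsto_exp_atTop.comp (tendsto_id.const_mul_atTop hε)).atTop_mul_const (by positivity)
  filter_upwards [hexp.eventually_gt_atTop (Real.exp (ε * T) * (y T - δ / 2)),
    eventually_ge_atTop T] with t ht1 ht2
  have h := hanti self_mem_Ici ht2 ht2
  have : Real.exp (ε * t) * (y t - δ / 2) < Real.exp (ε * t) * (δ / 2) := h.trans_lt ht1
  have := lt_of_mul_lt_mul_left this (Real.exp_pos _).le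
  linarith

theorem monotoneOn_of_deriv_nonneg_off_finite {f f' : ℝ → ℝ} {a : ℝ} (S : Finset ℝ)
    (hc : ContinuousOn f (Ici a)) (hf : ∀ t ∈ Ici a, t ∉ S → HasDerivWithinAt f (f' t) (Ici a) t)
    (hf' : ∀ t ∈ Ici a, 0 ≤ f' t) : MonotoneOn f (Ici a) := by
  -- Induction on the set of exceptional points: a new one splits the interval in two.
  have key : ∀ S : Finset ℝ, ∀ s t : ℝ, a ≤ s → s ≤ t →
      (∀ x ∈ Ioo s t, x ∉ S → HasDerivAt f (f' x) x) → f s ≤ f t := by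
    intro S
    induction S using Finset.induction_on with
    | empty =>
      intro s t has hst hd
      have hm : MonotoneOn f (Icc s t) := by
        refine monotoneOn_of_hasDerivWithinAt_nonneg (f' := f') (convex_Icc s t)
          (hc.mono fun x hx => has.trans hx.1) (fun x hx => ?_) (fun x hx => ?_)
        · rw [interior_Icc] at hx ⊢
          exact (hd x hx (by simp)).hasDerivWithinAt
        · rw [interior_Icc] at hx
          exact hf' x (has.trans hx.1.le)
      exact hm (left_mem_Icc.2 hst) (right_mem_Icc.2 hst) hst
    | insert b S _ ih =>
      intro s t has hst hd
      by_cases hb : b ∈ Ioo s t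
      · refine (ih s b has hb.1.le fun x hx hxS => hd x ⟨hx.1, hx.2.trans hb.2⟩ ?_).trans
          (ih b t (has.trans hb.1.le) hb.2.le fun x hx hxS => hd x ⟨hb.1.trans hx.1, hx.2⟩ ?_)
        · simp [hxS, hx.2.ne]
        · simp [hxS, hx.1.ne']
      · refine ih s t has hst fun x hx hxS => hd x hx ?_
        have : x ≠ b := fun h => hb (h ▸ hx)
        simp [hxS, this]
  intro s hs t _ hst
  refine key S s t hs hst fun x hx hxS => ?_
  have hax : a < x := lt_of_le_of_lt hs hx.1
  exact (hf x hax.le hxS).hasDerivAt (Ici_mem_nhds hax)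

/-! ### Global solutions of ordinary differential equations -/

/-- A bounded Lipschitz vector field is complete. -/
theorem exists_global_integralCurve {E : Type*} [NormedAddCommGroup E] [NormedSpace ℝ E]
    [CompleteSpace E] {f : E → E} {K L : NNReal} (hK : LipschitzWith K f) (hL : ∀ x, ‖f x‖ ≤ L)
    (x₀ : E) : ∃ γ : ℝ → E, γ 0 = x₀ ∧ ∀ t, HasDerivAt γ (f (γ t)) t := by
  have hloc : ∀ a : ℝ, 0 < a → ∃ γ : ℝ → E, γ 0 = x₀ ∧
      ∀ t ∈ Ioo (-a) a, HasDerivAt γ (f (γ t)) t := by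
    intro a ha
    have h0 : (0 : ℝ) ∈ Icc (-a) a := ⟨by linarith, ha.le⟩
    have hpl : IsPicardLindelof (fun _ => f) (⟨0, h0⟩ : Icc (-a) a) x₀ (L * ⟨a, ha.le⟩) 0 L K :=
      IsPicardLindelof.of_time_independent (fun x _ => hL x) hK.lipschitzOnWith (by
        have : ((L * ⟨a, ha.le⟩ : NNReal) : ℝ) = L * a := rfl
        simp [this])
    obtain ⟨γ, h1, h2⟩ := hpl.exists_eq_forall_mem_Icc_hasDerivWithinAt₀
    exact ⟨γ, h1, fun t ht => (h2 t (Ioo_subset_Icc_self ht)).hasDerivAt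
      (Icc_mem_nhds ht.1 ht.2)⟩
  choose! γ hγ0 hγ using hloc
  have huniq : ∀ a b : ℝ, 0 < a → a ≤ b → EqOn (γ a) (γ b) (Ioo (-a) a) := by
    intro a b ha hab
    refine ODE_solution_unique_of_mem_Ioo (v := fun _ => f) (s := fun _ => univ) (K := K) (t₀ := 0)
      (fun t _ => hK.lipschitzOnWith) ⟨by linarith, ha⟩
      (fun t ht => ⟨hγ a ha t ht, mem_univ _⟩)
      (fun t ht => ⟨hγ b (ha.trans_le hab) t ⟨by linarith [ht.1], by linarith [ht.2]⟩,
        mem_univ _⟩) ?_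
    rw [hγ0 a ha, hγ0 b (ha.trans_le hab)]
  refine ⟨fun t => γ (|t| + 1) t, hγ0 _ (by positivity), fun t => ?_⟩
  have hpos : 0 < |t| + 2 := by positivity
  have hmem : t ∈ Ioo (-(|t| + 1)) (|t| + 1) := abs_lt.1 (by linarith)
  have heq : (fun s => γ (|s| + 1) s) =ᶠ[𝓝 t] γ (|t| + 2) := by
    filter_upwards [Ioo_mem_nhds hmem.1 hmem.2] with s hs
    have hs' := abs_lt.2 hs
    exact huniq _ _ (by positivity) (by linarith) (abs_lt.1 (by linarith))
  have h := hγ (|t| + 2) hpos t (abs_lt.1 (by linarith))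
  rw [← heq.eq_of_nhds] at h
  exact h.congr_of_eventuallyEq heq

/-! ### Quadratic forms along trajectories -/

theorem posDef_dotProduct_pos {n : ℕ} {P : Matrix (Fin n) (Fin n) ℝ} (hP : P.PosDef)
    {x : Fin n → ℝ} (hx : x ≠ 0) : 0 < x ⬝ᵥ (P *ᵥ x) := by
  simpa using hP.dotProduct_mulVec_pos hx

theorem posDef_dotProduct_nonneg {n : ℕ} {P : Matrix (Fin n) (Fin n) ℝ} (hP : P.PosDef)
    (x : Fin n → ℝ) : 0 ≤ x ⬝ᵥ (P *ᵥ x) := by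
  by_cases hx : x = 0
  · simp [hx]
  · exact (posDef_dotProduct_pos hP hx).le

/-- A positive definite form dominates every quadratic form, by compactness of the unit sphere. -/
theorem exists_dotProduct_mulVec_le {n : ℕ} {P : Matrix (Fin n) (Fin n) ℝ} (hP : P.PosDef)
    (M : Matrix (Fin n) (Fin n) ℝ) :
    ∃ k : ℝ, 0 < k ∧ ∀ x : Fin n → ℝ, x ⬝ᵥ (M *ᵥ x) ≤ k * (x ⬝ᵥ (P *ᵥ x)) := by
  have hne : ∀ x ∈ Metric.sphere (0 : Fin n → ℝ) 1, x ≠ 0 := fun x hx h => by simp [h] at hx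
  have hcont : ContinuousOn (fun x : Fin n → ℝ => (x ⬝ᵥ (M *ᵥ x)) / (x ⬝ᵥ (P *ᵥ x)))
      (Metric.sphere 0 1) :=
    ContinuousOn.div (by fun_prop) (by fun_prop) fun x hx =>
      (posDef_dotProduct_pos hP (hne x hx)).ne'
  obtain ⟨k, hk⟩ := (isCompact_sphere (0 : Fin n → ℝ) 1).bddAbove_image hcont
  refine ⟨max k 1, by positivity, fun x => ?_⟩
  by_cases hx : x = 0
  · simp [hx]
  have hx0 : 0 < ‖x‖ := norm_pos_iff.2 hx
  have hmem : ‖x‖⁻¹ • x ∈ Metric.sphere (0 : Fin n → ℝ) 1 := by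
    simp [norm_smul, hx0.ne']
  have h := hk (mem_image_of_mem _ hmem)
  simp only [Matrix.mulVec_smul, dotProduct_smul, smul_dotProduct, smul_eq_mul] at h
  have hp := posDef_dotProduct_pos hP hx
  have hinv : ‖x‖⁻¹ ≠ 0 := by positivity
  rw [mul_div_mul_left _ _ hinv, mul_div_mul_left _ _ hinv, div_le_iff₀ hp] at h
  exact h.trans (mul_le_mul_of_nonneg_right (le_max_left _ _) hp.le)

theorem exists_sq_apply_le {n : ℕ} {P : Matrix (Fin n) (Fin n) ℝ} (hP : P.PosDef) (i : Fin n) :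
    ∃ k : ℝ, 0 < k ∧ ∀ x : Fin n → ℝ, x i ^ 2 ≤ k * (x ⬝ᵥ (P *ᵥ x)) := by
  obtain ⟨k, hk, h⟩ := exists_dotProduct_mulVec_le hP (Matrix.diagonal (Pi.single i 1))
  refine ⟨k, hk, fun x => (h x).trans' (le_of_eq ?_)⟩
  simp [dotProduct, Matrix.mulVec_diagonal, Pi.single_apply, sq]

theorem tendsto_zero_of_tendsto_quadForm {n : ℕ} {P : Matrix (Fin n) (Fin n) ℝ} (hP : P.PosDef)
    {f : ℝ → Fin n → ℝ} (hf : Tendsto (fun t => f t ⬝ᵥ (P *ᵥ f t)) atTop (𝓝 0)) :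
    Tendsto f atTop (𝓝 0) := by
  refine tendsto_pi_nhds.2 fun i => ?_
  obtain ⟨k, _, hk⟩ := exists_sq_apply_le hP i
  have h : Tendsto (fun t => f t i ^ 2) atTop (𝓝 0) :=
    squeeze_zero (fun t => sq_nonneg _) (fun t => hk (f t)) (by simpa using hf.const_mul k)
  have h2 := (Real.continuous_sqrt.tendsto 0).comp h
  rw [Real.sqrt_zero] at h2
  refine (tendsto_zero_iff_abs_tendsto_zero _).2 (h2.congr fun t => ?_)
  simp [Real.sqrt_sq_eq_abs]

theorem hasDerivWithinAt_mulVec {𝕜 : Type*} [RCLike 𝕜] {m n : ℕ} (M : Matrix (Fin m) (Fin n) 𝕜)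
    {f : ℝ → Fin n → 𝕜} {f' : Fin n → 𝕜} {s : Set ℝ} {t : ℝ} (hf : HasDerivWithinAt f f' s t) :
    HasDerivWithinAt (fun t => M *ᵥ f t) (M *ᵥ f') s t := by
  rw [hasDerivWithinAt_pi] at hf ⊢
  intro i
  simp only [Matrix.mulVec, dotProduct]
  exact HasDerivWithinAt.fun_sum fun j _ => (hf j).const_mul (M i j)

theorem hasDerivAt_mulVec {𝕜 : Type*} [RCLike 𝕜] {m n : ℕ} (M : Matrix (Fin m) (Fin n) 𝕜)
    {f : ℝ → Fin n → 𝕜} {f' : Fin n → 𝕜} {t : ℝ} (hf : HasDerivAt f f' t) :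
    HasDerivAt (fun t => M *ᵥ f t) (M *ᵥ f') t := by
  rw [← hasDerivWithinAt_univ] at hf ⊢
  exact hasDerivWithinAt_mulVec M hf

theorem dotProduct_mulVec_comm_of_isSymm {n : ℕ} {P : Matrix (Fin n) (Fin n) ℝ} (hP : Pᵀ = P)
    (x y : Fin n → ℝ) : x ⬝ᵥ (P *ᵥ y) = y ⬝ᵥ (P *ᵥ x) := by
  rw [Matrix.dotProduct_mulVec, ← Matrix.mulVec_transpose, hP, dotProduct_comm]

theorem hasDerivAt_quadForm {n : ℕ} {P : Matrix (Fin n) (Fin n) ℝ} (hP : Pᵀ = P)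
    {f : ℝ → Fin n → ℝ} {f' : Fin n → ℝ} {t : ℝ} (hf : HasDerivAt f f' t) :
    HasDerivAt (fun t => f t ⬝ᵥ (P *ᵥ f t)) (2 * (f t ⬝ᵥ (P *ᵥ f'))) t := by
  have h1 := hasDerivAt_pi.1 hf
  have h2 := hasDerivAt_pi.1 (hasDerivAt_mulVec P hf)
  have h3 : HasDerivAt (fun t => f t ⬝ᵥ (P *ᵥ f t))
      (∑ i, (f' i * (P *ᵥ f t) i + f t i * (P *ᵥ f') i)) t := by
    simp only [dotProduct]
    exact HasDerivAt.fun_sum fun i _ => (h1 i).mul (h2 i)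
  convert h3 using 1
  rw [Finset.sum_add_distrib]
  change _ = f' ⬝ᵥ (P *ᵥ f t) + f t ⬝ᵥ (P *ᵥ f')
  rw [dotProduct_mulVec_comm_of_isSymm hP f', two_mul]

/-! ### Hurwitz systems with vanishing input -/

theorem tendsto_zero_of_scalar_system {z : ℂ} (hz : z.re < 0) {ζ r : ℝ → ℂ}
    (hζ : ∀ᶠ t in atTop, HasDerivAt ζ (z * ζ t + r t) t) (hr : Tendsto r atTop (𝓝 0)) :
    Tendsto ζ atTop (𝓝 0) := by
  have hy : Tendsto (fun t => ‖ζ t‖ ^ 2) atTop (𝓝 0) := by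
    refine tendsto_zero_of_deriv_le_neg_mul_add (ε := -z.re)
      (r := fun t => (-z.re)⁻¹ * ‖r t‖ ^ 2) (by linarith)
      (Eventually.of_forall fun t => by positivity)
      (hζ.mono fun t ht => ht.norm_sq) (Eventually.of_forall fun t => ?_) ?_
    · have h1 : inner ℝ (ζ t) (z * ζ t + r t) = z.re * ‖ζ t‖ ^ 2 + inner ℝ (ζ t) (r t) := by
        rw [inner_add_right]
        congr 1
        rw [Complex.inner, ← Complex.normSq_eq_norm_sq, Complex.normSq_apply]
        simp
        ring
      have h2 := real_inner_le_norm (ζ t) (r t)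
      have ha : 0 < -z.re := by linarith
      have h3 : 2 * (‖ζ t‖ * ‖r t‖) ≤ -z.re * ‖ζ t‖ ^ 2 + (-z.re)⁻¹ * ‖r t‖ ^ 2 := by
        have h4 : -z.re * ‖ζ t‖ ^ 2 + (-z.re)⁻¹ * ‖r t‖ ^ 2 - 2 * (‖ζ t‖ * ‖r t‖)
            = (-z.re)⁻¹ * (-z.re * ‖ζ t‖ - ‖r t‖) ^ 2 := by
          have h5 : (-z.re)⁻¹ * -z.re = 1 := inv_mul_cancel₀ ha.ne'
          linear_combination (-(-z.re * ‖ζ t‖ ^ 2) + 2 * (‖ζ t‖ * ‖r t‖)) * h5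
        have : 0 ≤ (-z.re)⁻¹ * (-z.re * ‖ζ t‖ - ‖r t‖) ^ 2 := by positivity
        linarith
      rw [h1]
      linarith
    · simpa using ((hr.norm).pow 2).const_mul (-z.re)⁻¹
  have h2 := (Real.continuous_sqrt.tendsto 0).comp hy
  rw [Real.sqrt_zero] at h2
  refine tendsto_zero_iff_norm_tendsto_zero.2 (h2.congr fun t => ?_)
  simp

theorem tendsto_mulVec_zero {𝕜 : Type*} [RCLike 𝕜] {m n : ℕ} (M : Matrix (Fin m) (Fin n) 𝕜)
    {f : ℝ → Fin n → 𝕜} (hf : Tendsto f atTop (𝓝 0)) :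
    Tendsto (fun t => M *ᵥ f t) atTop (𝓝 0) := by
  have h : Continuous fun x : Fin n → 𝕜 => M *ᵥ x := by fun_prop
  have h2 := (h.tendsto 0).comp hf
  rw [Matrix.mulVec_zero] at h2
  exact h2

/-- The factors `M - z` of the polynomial are peeled off one at a time: if `q(M) (M - z) ζ` tends
to zero, then `q(M) ζ` solves a scalar system with rate `z` and vanishing input. -/
theorem tendsto_zero_of_tendsto_aeval {n : ℕ} (M : Matrix (Fin n) (Fin n) ℂ) {ζ r : ℝ → Fin n → ℂ}
    (hζ : ∀ᶠ t in atTop, HasDerivAt ζ (M *ᵥ ζ t + r t) t) (hr : Tendsto r atTop (𝓝 0))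
    (s : Multiset ℂ) (hs : ∀ z ∈ s, z.re < 0)
    (h : Tendsto (fun t => Polynomial.aeval M (s.map fun z => Polynomial.X - Polynomial.C z).prod
      *ᵥ ζ t) atTop (𝓝 0)) : Tendsto ζ atTop (𝓝 0) := by
  induction s using Multiset.induction_on with
  | empty => simpa using h
  | cons z s ih =>
    refine ih (fun w hw => hs w (Multiset.mem_cons_of_mem hw)) ?_
    set q := (s.map fun z => Polynomial.X - Polynomial.C z).prod with hq
    set D := Polynomial.aeval M q with hD
    have hcomm : D * M = M * D := by
      have h1 := (Polynomial.aeval M).map_mul q Polynomial.X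
      have h2 := (Polynomial.aeval M).map_mul Polynomial.X q
      rw [mul_comm] at h2
      simpa [Polynomial.aeval_X, hD] using h1.symm.trans h2
    have hfac : Polynomial.aeval M
        ((z ::ₘ s).map fun z => Polynomial.X - Polynomial.C z).prod = M * D - z • D := by
      rw [Multiset.map_cons, Multiset.prod_cons, ← hq, map_mul, ← hD, map_sub, Polynomial.aeval_X,
        Polynomial.aeval_C, sub_mul, Algebra.algebraMap_eq_smul_one, smul_mul_assoc, one_mul]
    rw [hfac] at h
    refine tendsto_pi_nhds.2 fun i => ?_
    refine tendsto_zero_of_scalar_system (hs z (Multiset.mem_cons_self z s))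
      (r := fun t => ((M * D - z • D) *ᵥ ζ t + D *ᵥ r t) i) ?_ ?_
    · filter_upwards [hζ] with t ht
      have h1 := hasDerivAt_pi.1 (hasDerivAt_mulVec D ht) i
      refine h1.congr_deriv ?_
      rw [Matrix.mulVec_add, Matrix.mulVec_mulVec, hcomm, Matrix.sub_mulVec, Matrix.smul_mulVec]
      simp only [Pi.add_apply, Pi.sub_apply, Pi.smul_apply, smul_eq_mul]
      ring
    · have h1 := h.add (tendsto_mulVec_zero D hr)
      rw [add_zero] at h1
      exact tendsto_pi_nhds.1 h1 i

/-- A Hurwitz system driven by a vanishing input converges to zero: by the Cayley–Hamilton theorem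
`tendsto_zero_of_tendsto_aeval` applies to the roots of the characteristic polynomial. -/
theorem tendsto_zero_of_isHurwitz {n : ℕ} {M : Matrix (Fin n) (Fin n) ℝ} (hM : IsHurwitz M)
    {ζ r : ℝ → Fin n → ℝ} (hζ : ∀ᶠ t in atTop, HasDerivAt ζ (M *ᵥ ζ t + r t) t)
    (hr : Tendsto r atTop (𝓝 0)) : Tendsto ζ atTop (𝓝 0) := by
  set M' := M.map (algebraMap ℝ ℂ) with hM'
  have hC : Tendsto (fun t i => (ζ t i : ℂ)) atTop (𝓝 0) := by
    refine tendsto_zero_of_tendsto_aeval M' (r := fun t i => (r t i : ℂ)) ?_ ?_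
      M'.charpoly.roots ?_ ?_
    · filter_upwards [hζ] with t ht
      refine hasDerivAt_pi.2 fun i => ?_
      refine (hasDerivAt_pi.1 ht i).ofReal_comp.congr_deriv ?_
      simp [Matrix.mulVec, dotProduct, hM']
    · refine tendsto_pi_nhds.2 fun i => ?_
      exact (Complex.continuous_ofReal.tendsto' 0 0 Complex.ofReal_zero).comp
        (tendsto_pi_nhds.1 hr i)
    · intro z hz
      exact hM z (Matrix.mem_spectrum_iff_isRoot_charpoly.2 (Polynomial.isRoot_of_mem_roots hz))
    · have h1 := (IsAlgClosed.splits M'.charpoly).eq_prod_roots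
      rw [M'.charpoly_monic.leadingCoeff, Polynomial.C_1, one_mul] at h1
      rw [← h1, Matrix.aeval_self_charpoly]
      simp
  refine tendsto_pi_nhds.2 fun i => ?_
  exact (Complex.continuous_re.tendsto' 0 0 Complex.zero_re).comp (tendsto_pi_nhds.1 hC i)

/-! ### Linear systems with piecewise continuous input -/

theorem exp_smul_mul_exp_neg_smul {E : Type*} [NormedAddCommGroup E] [NormedSpace ℝ E]
    [CompleteSpace E] (L : E →L[ℝ] E) (t : ℝ) :
    NormedSpace.exp (t • L) * NormedSpace.exp ((-t) • L) = 1 := by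
  let _ : NormedAlgebra ℚ (E →L[ℝ] E) := NormedAlgebra.restrictScalars ℚ ℝ _
  rw [← NormedSpace.exp_add_of_commute, neg_smul, add_neg_cancel, NormedSpace.exp_zero]
  exact ((Commute.refl L).smul_left t).smul_right (-t)

theorem continuous_exp_smul {E : Type*} [NormedAddCommGroup E] [NormedSpace ℝ E]
    [CompleteSpace E] (L : E →L[ℝ] E) : Continuous fun t : ℝ => NormedSpace.exp (t • L) :=
  continuous_iff_continuousAt.2 fun t => (hasDerivAt_exp_smul_const L t).continuousAt

/-- Variation of constants for an input that is continuous off a finite set and locally bounded. -/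
theorem exists_solution_linear_with_input {E : Type*} [NormedAddCommGroup E] [NormedSpace ℝ E]
    [CompleteSpace E] (L : E →L[ℝ] E) {g : ℝ → E} (S : Finset ℝ)
    (hg : ∀ t, t ∉ S → ContinuousAt g t) (hb : ∀ T : ℝ, ∃ C : ℝ, ∀ t ∈ Icc (-T) T, ‖g t‖ ≤ C)
    (ζ₀ : E) : ∃ ζ : ℝ → E, Continuous ζ ∧ ζ 0 = ζ₀ ∧
      ∀ t, t ∉ S → HasDerivAt ζ (L (ζ t) + g t) t := by
  set G : ℝ → E := fun s => NormedSpace.exp ((-s) • L) (g s) with hG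
  have hexp : Continuous fun s : ℝ => NormedSpace.exp ((-s) • L) :=
    (continuous_exp_smul L).comp continuous_neg
  have hGc : ∀ t, t ∉ S → ContinuousAt G t := fun t ht => hexp.continuousAt.clm_apply (hg t ht)
  have hmeas : MeasureTheory.AEStronglyMeasurable G MeasureTheory.volume := by
    have h0 : ∀ᵐ x : ℝ, x ∈ (S : Set ℝ)ᶜ :=
      MeasureTheory.compl_mem_ae_iff.2 (S.finite_toSet.measure_zero _)
    have h1 : ContinuousOn G (S : Set ℝ)ᶜ := fun t ht =>
      (hGc t (by simpa using ht)).continuousWithinAt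
    have h2 := h1.aestronglyMeasurable (μ := MeasureTheory.volume)
      S.finite_toSet.measurableSet.compl
    rwa [MeasureTheory.Measure.restrict_eq_self_of_ae_mem h0] at h2
  have hint : ∀ a b, IntervalIntegrable G MeasureTheory.volume a b := by
    intro a b
    set T := max |a| |b|
    obtain ⟨C, hC⟩ := hb T
    obtain ⟨D, hD⟩ := (isCompact_Icc (a := -T) (b := T)).bddAbove_image (hexp.norm.continuousOn)
    have hsub : uIcc a b ⊆ Icc (-T) T := uIcc_subset_Icc
      ⟨(neg_le_neg (le_max_left _ _)).trans (neg_abs_le a), (le_abs_self a).trans (le_max_left _ _)⟩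
      ⟨(neg_le_neg (le_max_right _ _)).trans (neg_abs_le b),
        (le_abs_self b).trans (le_max_right _ _)⟩
    rw [intervalIntegrable_iff]
    refine MeasureTheory.Measure.integrableOn_of_bounded (M := D * C) (by simp)
      hmeas ?_
    refine (MeasureTheory.ae_restrict_iff' measurableSet_uIoc).2 (Eventually.of_forall ?_)
    intro t ht
    have ht' := hsub (uIoc_subset_uIcc ht)
    have h1 := hD (mem_image_of_mem _ ht')
    exact (ContinuousLinearMap.le_opNorm _ _).trans
      (mul_le_mul h1 (hC t ht') (norm_nonneg _) ((norm_nonneg _).trans h1))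
  refine ⟨fun t => NormedSpace.exp (t • L) (ζ₀ + ∫ s in (0 : ℝ)..t, G s), ?_, ?_, fun t ht => ?_⟩
  · exact (continuous_exp_smul L).clm_apply
      (continuous_const.add (intervalIntegral.continuous_primitive hint 0))
  · simp [NormedSpace.exp_zero]
  · have h1 : HasDerivAt (fun t => ∫ s in (0 : ℝ)..t, G s) (G t) t :=
      intervalIntegral.integral_hasDerivAt_right (hint 0 t)
        hmeas.stronglyMeasurableAtFilter (hGc t ht)
    convert (hasDerivAt_exp_smul_const' L t).clm_apply (h1.const_add ζ₀) using 1
    have h2 := congrArg (fun T : E →L[ℝ] E => T (g t)) (exp_smul_mul_exp_neg_smul L t)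
    simp only [mul_apply_eq_comp, one_apply_eq_self] at h2
    rw [mul_apply_eq_comp, hG]
    simp only
    rw [h2]

/-- A function that is locally constant on a half-line off finitely many points is bounded: between
consecutive exceptional points it has a single value. -/
theorem exists_bound_of_deriv_zero_off_finite {E : Type*} [NormedAddCommGroup E] [NormedSpace ℝ E]
    {f : ℝ → E} {a : ℝ} (S : Finset ℝ)
    (hf : ∀ t ∈ Ici a, t ∉ S → HasDerivWithinAt f 0 (Ici a) t) :
    ∃ C : ℝ, ∀ t ∈ Ici a, ‖f t‖ ≤ C := by
  have hconst : ∀ s ∈ Ici a, ∀ t, s ≤ t → (∀ x ∈ Icc s t, x ∉ S) → f t = f s := by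
    intro s hs t hst hS
    have hsub : ∀ x ∈ Icc s t, x ∈ Ici a := fun x hx => (mem_Ici.1 hs).trans hx.1
    refine constant_of_has_deriv_right_zero
      (fun x hx => ((hf x (hsub x hx) (hS x hx)).continuousWithinAt).mono hsub)
      (fun x hx => ?_) t (right_mem_Icc.2 hst)
    have hx' := Ico_subset_Icc_self hx
    exact (hf x (hsub x hx') (hS x hx')).mono (Ici_subset_Ici.2 (hsub x hx'))
  have hval : ∀ s ∈ Ici a, s ∉ S → ∀ t ∈ Ici a, t ∉ S → S.filter (· < s) = S.filter (· < t) →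
      s ≤ t → f t = f s := by
    intro s hs hsS t _ _ hst hle
    refine hconst s hs t hle fun x hx hxS => ?_
    by_cases hxt : x = t
    · subst hxt; contradiction
    · have : x ∈ S.filter (· < t) := Finset.mem_filter.2 ⟨hxS, lt_of_le_of_ne hx.2 hxt⟩
      rw [← hst] at this
      exact absurd (Finset.mem_filter.1 this).2 (not_lt.2 hx.1)
  have hfin : (f '' (Ici a \ S)).Finite := by
    classical
    -- The value at `t` is determined by the set of exceptional points before `t`.
    have hinj : InjOn (fun v : E => {F : Finset ℝ | ∃ t ∈ Ici a, t ∉ S ∧ f t = v ∧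
        S.filter (· < t) = F}) (f '' (Ici a \ S)) := by
      rintro _ ⟨s, ⟨hs, hsS⟩, rfl⟩ w _ hvw
      have hsS' : s ∉ S := by simpa using hsS
      have h1 : S.filter (· < s) ∈ {F : Finset ℝ | ∃ t ∈ Ici a, t ∉ S ∧ f t = f s ∧
        S.filter (· < t) = F} := ⟨s, hs, hsS', rfl, rfl⟩
      simp only at hvw
      rw [hvw] at h1
      obtain ⟨t, ht, htS, rfl, hF⟩ := h1
      rcases le_total s t with h | h
      · exact (hval s hs hsS' t ht htS hF.symm h).symm
      · exact hval t ht htS s hs hsS' hF h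
    refine Set.Finite.of_finite_image (Set.Finite.subset
      (Set.Finite.powerset (Finset.finite_toSet S.powerset)) ?_) hinj
    rintro _ ⟨v, _, rfl⟩ F ⟨t, _, _, _, rfl⟩
    exact Finset.mem_coe.2 (Finset.mem_powerset.2 (Finset.filter_subset _ _))
  have hbd : (f '' (Ici a)).Finite := by
    refine (hfin.union ((S.finite_toSet).image f)).subset ?_
    rintro _ ⟨t, ht, rfl⟩
    by_cases htS : t ∈ S
    · exact Or.inr ⟨t, htS, rfl⟩
    · exact Or.inl ⟨t, ⟨ht, by simpa using htS⟩, rfl⟩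
  obtain ⟨C, hC⟩ := hbd.isBounded.exists_norm_le
  exact ⟨C, fun t ht => hC _ (mem_image_of_mem f ht)⟩

/-- A piecewise solution of a linear system with finitely many jumps is locally bounded, since
`exp (-t M) h` is piecewise constant. -/
theorem exists_bound_of_linear_off_finite {n : ℕ} {M : Matrix (Fin n) (Fin n) ℝ}
    {h : ℝ → Fin n → ℝ} (S : Finset ℝ)
    (hh : ∀ t : ℝ, 0 ≤ t → t ∉ S → HasDerivWithinAt h (M *ᵥ h t) (Ici 0) t) (T : ℝ) :
    ∃ C : ℝ, ∀ t ∈ Icc 0 T, ‖h t‖ ≤ C := by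
  set L : (Fin n → ℝ) →L[ℝ] (Fin n → ℝ) := LinearMap.toContinuousLinearMap (Matrix.toLin' M)
  have hL : ∀ x, L x = M *ᵥ x := fun x => by simp [L]
  obtain ⟨C, hC⟩ := exists_bound_of_deriv_zero_off_finite
    (f := fun t => NormedSpace.exp (t • (-L)) (h t)) (a := 0) S (by
      intro t ht htS
      convert ((hasDerivAt_exp_smul_const (-L) t).hasDerivWithinAt).clm_apply (hh t ht htS) using 1
      simp [hL])
  obtain ⟨D, hD⟩ := (isCompact_Icc (a := 0) (b := T)).bddAbove_image
    ((continuous_exp_smul L).norm.continuousOn)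
  refine ⟨D * C, fun t ht => ?_⟩
  have h1 := congrArg (fun T : (Fin n → ℝ) →L[ℝ] (Fin n → ℝ) => T (h t))
    (exp_smul_mul_exp_neg_smul L t)
  simp only [mul_apply_eq_comp, one_apply_eq_self] at h1
  rw [← h1, neg_smul, ← smul_neg]
  have h2 := hD (mem_image_of_mem _ ht)
  exact (ContinuousLinearMap.le_opNorm _ _).trans
    (mul_le_mul h2 (hC t ht.1) (norm_nonneg _) ((norm_nonneg _).trans h2))

/-! ### The follower Laplacian -/

/-- The graph Laplacian restricted to the followers: row `i` has off-diagonal entries `-a_{ij}` and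
row sum equal to the weight `a_{i0}` of the leader. -/
def followerLaplacian {N : ℕ} (a : Matrix (Fin (N + 1)) (Fin (N + 1)) ℝ) :
    Matrix (Fin N) (Fin N) ℝ :=
  fun i j => (if i = j then ∑ k, a i.succ k else 0) - a i.succ j.succ

theorem sum_followerLaplacian_smul {N : ℕ} {V : Type*} [AddCommGroup V] [Module ℝ V]
    (a : Matrix (Fin (N + 1)) (Fin (N + 1)) ℝ) (δ : Fin (N + 1) → V) (i : Fin N) :
    ∑ j, followerLaplacian a i j • (δ j.succ - δ 0) = ∑ j, a i.succ j • (δ i.succ - δ j) := by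
  have h : ∑ j, a i.succ j • (δ i.succ - δ j)
      = ∑ j, a i.succ j • (δ i.succ - δ 0) - ∑ j, a i.succ j • (δ j - δ 0) := by
    rw [← Finset.sum_sub_distrib]
    refine Finset.sum_congr rfl fun j _ => ?_
    rw [← smul_sub, sub_sub_sub_cancel_right]
  simp only [h, followerLaplacian, sub_smul, ite_smul, zero_smul, Finset.sum_sub_distrib,
    Finset.sum_ite_eq, Finset.mem_univ, if_true, Finset.sum_smul]
  congr 1
  rw [Fin.sum_univ_succ (fun j => a i.succ j • (δ j - δ 0)), sub_self, smul_zero, zero_add]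

theorem sum_followerLaplacian {N : ℕ} (a : Matrix (Fin (N + 1)) (Fin (N + 1)) ℝ) (i : Fin N) :
    ∑ j, followerLaplacian a i j = a i.succ 0 := by
  simp only [followerLaplacian, Finset.sum_sub_distrib, Finset.sum_ite_eq, Finset.mem_univ,
    if_true]
  rw [Fin.sum_univ_succ (fun k => a i.succ k)]
  ring

theorem followerLaplacian_nonpos_of_ne {N : ℕ} {a : Matrix (Fin (N + 1)) (Fin (N + 1)) ℝ}
    (ha : IsLeaderFollowerAdjacency a) {i j : Fin N} (hij : i ≠ j) :
    followerLaplacian a i j ≤ 0 := by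
  simp [followerLaplacian, hij, ha.nonneg]

/-- Minimum principle: extend `x` by zero to the leader. At a minimizer every neighbour is again a
minimizer, so the minimum is attained at the leader. -/
theorem nonneg_of_followerLaplacian_mulVec_nonneg {N : ℕ}
    {a : Matrix (Fin (N + 1)) (Fin (N + 1)) ℝ} (ha : IsLeaderFollowerAdjacency a)
    (htree : HasSpanningTreeRootedAtLeader a) {x : Fin N → ℝ}
    (hx : ∀ i, 0 ≤ (followerLaplacian a *ᵥ x) i) (i : Fin N) : 0 ≤ x i := by
  set z : Fin (N + 1) → ℝ := Fin.cons 0 x with hz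
  obtain ⟨i₀, hmin⟩ := Finite.exists_min z
  have hrow : ∀ i : Fin N, 0 ≤ ∑ j, a i.succ j * (z i.succ - z j) := fun i => by
    have h := sum_followerLaplacian_smul a z i
    simp only [smul_eq_mul] at h
    rw [← h]
    simpa [hz, Matrix.mulVec, dotProduct] using hx i
  have hroot : ∀ k, Relation.ReflTransGen (fun j k => 0 < a k j) 0 k → z k = z i₀ →
      z 0 = z i₀ := by
    intro k hk
    induction hk with
    | refl => exact id
    | @tail j k _ hjk ih =>
      intro hzk
      refine ih ?_
      induction k using Fin.cases with
      | zero => rw [ha.leader] at hjk; exact absurd hjk (lt_irrefl _)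
      | succ k =>
        have hterm : ∀ l ∈ Finset.univ, a k.succ l * (z k.succ - z l) ≤ 0 := fun l _ =>
          mul_nonpos_of_nonneg_of_nonpos (ha.nonneg _ _) (by rw [hzk]; linarith [hmin l])
        have hsum := le_antisymm (Finset.sum_nonpos hterm) (hrow k)
        have h0 := (Finset.sum_eq_zero_iff_of_nonpos hterm).1 hsum j (Finset.mem_univ j)
        have := (mul_eq_zero.1 h0).resolve_left hjk.ne'
        linarith
  have h0 := hroot i₀ (htree i₀) rfl
  have h1 := hmin i.succ
  rw [← h0] at h1
  simpa [hz] using h1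

theorem isUnit_det_followerLaplacian {N : ℕ} {a : Matrix (Fin (N + 1)) (Fin (N + 1)) ℝ}
    (ha : IsLeaderFollowerAdjacency a) (htree : HasSpanningTreeRootedAtLeader a) :
    IsUnit (followerLaplacian a).det := by
  rw [← Matrix.isUnit_iff_isUnit_det, ← Matrix.mulVec_injective_iff_isUnit]
  have hle : ∀ x y, followerLaplacian a *ᵥ x = followerLaplacian a *ᵥ y → ∀ i, x i ≤ y i := by
    intro x y hxy i
    have h := nonneg_of_followerLaplacian_mulVec_nonneg ha htree (x := y - x)
      (fun i => by rw [Matrix.mulVec_sub, hxy, sub_self]; exact le_rfl) i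
    simpa using h
  intro x y hxy
  exact funext fun i => le_antisymm (hle x y hxy i) (hle y x hxy.symm i)

theorem followerLaplacian_inv_nonneg {N : ℕ} {a : Matrix (Fin (N + 1)) (Fin (N + 1)) ℝ}
    (ha : IsLeaderFollowerAdjacency a) (htree : HasSpanningTreeRootedAtLeader a) (i j : Fin N) :
    0 ≤ (followerLaplacian a)⁻¹ i j := by
  have h := nonneg_of_followerLaplacian_mulVec_nonneg ha htree
    (x := (followerLaplacian a)⁻¹ *ᵥ Pi.single j 1) (fun k => by
      rw [Matrix.mulVec_mulVec, Matrix.mul_nonsing_inv _ (isUnit_det_followerLaplacian ha htree),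
        Matrix.one_mulVec]
      by_cases hk : k = j
      · subst hk; simp
      · simp [hk]) i
  simpa using h

/-- Diagonal stability of the follower Laplacian `L`. With `p = L⁻¹ 1` and `q = L⁻ᵀ 1`, both
positive, the weights are `g = q / p`; the off-diagonal terms are bounded by the weighted
arithmetic–geometric mean inequality, after which the row and column sums of `L` scaled by `p`
and `q` are one. -/
theorem exists_weights_followerLaplacian {N : ℕ} {a : Matrix (Fin (N + 1)) (Fin (N + 1)) ℝ}
    (ha : IsLeaderFollowerAdjacency a) (htree : HasSpanningTreeRootedAtLeader a) :
    ∃ g l : Fin N → ℝ, (∀ i, 0 < g i) ∧ (∀ i, 0 < l i) ∧ ∀ y : Fin N → ℝ,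
      ∑ i, l i * y i ^ 2 ≤ 2 * ∑ i, ∑ j, g i * followerLaplacian a i j * (y i * y j) := by
  set M := followerLaplacian a with hM
  have hdet := isUnit_det_followerLaplacian ha htree
  have hinv := followerLaplacian_inv_nonneg ha htree
  rw [← hM] at hdet hinv
  set p : Fin N → ℝ := fun i => ∑ j, M⁻¹ i j with hp
  set q : Fin N → ℝ := fun j => ∑ i, M⁻¹ i j with hq
  have hMp : ∀ i, ∑ j, M i j * p j = 1 := fun i => by
    have h : ∀ j, M i j * p j = ∑ k, M i j * M⁻¹ j k := fun j => Finset.mul_sum _ _ _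
    simp_rw [h]
    rw [Finset.sum_comm]
    have h2 : ∀ k, ∑ j, M i j * M⁻¹ j k = (1 : Matrix (Fin N) (Fin N) ℝ) i k := fun k => by
      rw [← Matrix.mul_nonsing_inv _ hdet, Matrix.mul_apply]
    simp [h2, Matrix.one_apply]
  have hMq : ∀ j, ∑ i, q i * M i j = 1 := fun j => by
    have h : ∀ i, q i * M i j = ∑ k, M⁻¹ k i * M i j := fun i => Finset.sum_mul _ _ _
    simp_rw [h]
    rw [Finset.sum_comm]
    have h2 : ∀ k, ∑ i, M⁻¹ k i * M i j = (1 : Matrix (Fin N) (Fin N) ℝ) k j := fun k => by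
      rw [← Matrix.nonsing_inv_mul _ hdet, Matrix.mul_apply]
    simp [h2, Matrix.one_apply]
  have hppos : ∀ i, 0 < p i := fun i => by
    refine (Finset.sum_nonneg fun j _ => hinv i j).lt_of_ne fun h0 => ?_
    have h1 := (Finset.sum_eq_zero_iff_of_nonneg fun j _ => hinv i j).1 h0.symm
    have h2 := congrFun (congrFun (Matrix.nonsing_inv_mul _ hdet) i) i
    rw [Matrix.mul_apply, Finset.sum_eq_zero fun j hj => by rw [h1 j hj, zero_mul]] at h2
    simp at h2
  have hqpos : ∀ i, 0 < q i := fun i => by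
    refine (Finset.sum_nonneg fun j _ => hinv j i).lt_of_ne fun h0 => ?_
    have h1 := (Finset.sum_eq_zero_iff_of_nonneg fun j _ => hinv j i).1 h0.symm
    have h2 := congrFun (congrFun (Matrix.mul_nonsing_inv _ hdet) i) i
    rw [Matrix.mul_apply, Finset.sum_eq_zero fun j hj => by rw [h1 j hj, mul_zero]] at h2
    simp at h2
  refine ⟨fun i => q i / p i, fun i => (q i / p i + 1) / p i,
    fun i => div_pos (hqpos i) (hppos i), fun i => ?_, fun y => ?_⟩
  · have := hppos i
    have := hqpos i
    positivity
  have hterm : ∀ i j, q i / p i * M i j * (p j / p i * y i ^ 2 + p i / p j * y j ^ 2)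
      ≤ 2 * (q i / p i * M i j * (y i * y j)) := by
    intro i j
    have hpi := hppos i
    have hpj := hppos j
    by_cases hij : i = j
    · subst hij
      rw [div_self hpi.ne']
      exact le_of_eq (by ring)
    have hamgm : 2 * (y i * y j) ≤ p j / p i * y i ^ 2 + p i / p j * y j ^ 2 := by
      have h : p j / p i * y i ^ 2 + p i / p j * y j ^ 2 - 2 * (y i * y j)
          = (p j * y i - p i * y j) ^ 2 / (p i * p j) := by
        field_simp
        ring
      have : 0 ≤ (p j * y i - p i * y j) ^ 2 / (p i * p j) := by positivity
      linarith
    have hneg : q i / p i * M i j ≤ 0 := mul_nonpos_of_nonneg_of_nonpos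
      (div_pos (hqpos i) hpi).le (followerLaplacian_nonpos_of_ne ha hij)
    linarith [mul_le_mul_of_nonpos_left hamgm hneg]
  have hsum := Finset.sum_le_sum fun i (_ : i ∈ Finset.univ) =>
    Finset.sum_le_sum fun j (_ : j ∈ Finset.univ) => hterm i j
  simp only [← Finset.mul_sum] at hsum
  refine le_trans (le_of_eq ?_) hsum
  have e1 : ∑ i, ∑ j, q i / p i * M i j * (p j / p i * y i ^ 2)
      = ∑ i, q i / p i / p i * y i ^ 2 := by
    refine Finset.sum_congr rfl fun i _ => ?_
    calc ∑ j, q i / p i * M i j * (p j / p i * y i ^ 2)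
        = q i / p i / p i * y i ^ 2 * ∑ j, M i j * p j := by
          rw [Finset.mul_sum]
          exact Finset.sum_congr rfl fun j _ => by ring
      _ = _ := by rw [hMp, mul_one]
  have e2 : ∑ i, ∑ j, q i / p i * M i j * (p i / p j * y j ^ 2) = ∑ j, 1 / p j * y j ^ 2 := by
    rw [Finset.sum_comm]
    refine Finset.sum_congr rfl fun j _ => ?_
    calc ∑ i, q i / p i * M i j * (p i / p j * y j ^ 2)
        = 1 / p j * y j ^ 2 * ∑ i, q i * M i j := by
          rw [Finset.mul_sum]
          refine Finset.sum_congr rfl fun i _ => ?_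
          have := (hppos i).ne'
          field_simp
      _ = _ := by rw [hMq, mul_one]
  simp only [mul_add, Finset.sum_add_distrib]
  rw [e1, e2, ← Finset.sum_add_distrib]
  exact Finset.sum_congr rfl fun i _ => by ring

/-! ### The observer error system and its Lyapunov function -/

/-- State `(e, δ, c)` of the observer error system: the leader's observer error `e = w₀ - x₀`, the
followers' errors `δ_i = (v_i - w_i) - (v_0 - w_0)` and the coupling weights `c_i`. -/
abbrev ObserverState (N n : ℕ) := (Fin n → ℝ) × (Fin N → Fin n → ℝ) × (Fin N → ℝ)

/-- The relative errors `ϱ_i = ∑_j L_{ij} δ_j`, with `L` the follower Laplacian. -/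
def relErr {N n : ℕ} (a : Matrix (Fin (N + 1)) (Fin (N + 1)) ℝ) (δ : Fin N → Fin n → ℝ)
    (i : Fin N) : Fin n → ℝ :=
  ∑ j, followerLaplacian a i j • δ j

/-- The adaptive gain `ρ_i = ϱ_iᵀ Q ϱ_i`. -/
def errEnergy {N n : ℕ} (Q : Matrix (Fin n) (Fin n) ℝ) (a : Matrix (Fin (N + 1)) (Fin (N + 1)) ℝ)
    (δ : Fin N → Fin n → ℝ) (i : Fin N) : ℝ :=
  relErr a δ i ⬝ᵥ (Q *ᵥ relErr a δ i)

/-- The autonomous vector field of the observer error system; neither the formation shape nor the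
agents' states occur in it. -/
def observerField {N n q : ℕ} (A : Matrix (Fin n) (Fin n) ℝ) (C : Matrix (Fin q) (Fin n) ℝ)
    (F : Matrix (Fin n) (Fin q) ℝ) (Q : Matrix (Fin n) (Fin n) ℝ)
    (a : Matrix (Fin (N + 1)) (Fin (N + 1)) ℝ) (z : ObserverState N n) : ObserverState N n :=
  ((A + F * C) *ᵥ z.1,
    fun i => A *ᵥ z.2.1 i + (z.2.2 i + errEnergy Q a z.2.1 i) • ((F * C) *ᵥ relErr a z.2.1 i)
      + (F * C) *ᵥ z.1,
    fun i => (C *ᵥ relErr a z.2.1 i) ⬝ᵥ (C *ᵥ relErr a z.2.1 i))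

/-- The energy `∑ g_i (c_i ρ_i + ρ_i² / 2)` of the relative errors. -/
noncomputable def storage {N n : ℕ} (Q : Matrix (Fin n) (Fin n) ℝ)
    (a : Matrix (Fin (N + 1)) (Fin (N + 1)) ℝ)
    (g : Fin N → ℝ) (z : ObserverState N n) : ℝ :=
  ∑ i, g i * (z.2.2 i * errEnergy Q a z.2.1 i + errEnergy Q a z.2.1 i ^ 2 / 2)

/-- The derivative of `storage` at `z` in the direction `z'`. -/
def storageDeriv {N n : ℕ} (Q : Matrix (Fin n) (Fin n) ℝ)
    (a : Matrix (Fin (N + 1)) (Fin (N + 1)) ℝ) (g : Fin N → ℝ) (z z' : ObserverState N n) : ℝ :=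
  ∑ i, g i * (z'.2.2 i * errEnergy Q a z.2.1 i + (z.2.2 i + errEnergy Q a z.2.1 i)
    * (2 * (relErr a z.2.1 i ⬝ᵥ (Q *ᵥ relErr a z'.2.1 i))))

/-- The Lyapunov function: the storage, the energy of the leader's observer error, and the squared
distances of the coupling weights from constants `α_i`. -/
noncomputable def lyapunov {N n : ℕ} (Q : Matrix (Fin n) (Fin n) ℝ)
    (a : Matrix (Fin (N + 1)) (Fin (N + 1)) ℝ)
    (g α : Fin N → ℝ) (κ : ℝ) (z : ObserverState N n) : ℝ :=
  storage Q a g z + κ * (z.1 ⬝ᵥ (Q *ᵥ z.1)) + ∑ i, (z.2.2 i - α i) ^ 2 / 2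

theorem errEnergy_nonneg {N n : ℕ} {Q : Matrix (Fin n) (Fin n) ℝ} (hQ : Q.PosDef)
    (a : Matrix (Fin (N + 1)) (Fin (N + 1)) ℝ) (δ : Fin N → Fin n → ℝ) (i : Fin N) :
    0 ≤ errEnergy Q a δ i :=
  posDef_dotProduct_nonneg hQ _

theorem relErr_smul {N n : ℕ} (a : Matrix (Fin (N + 1)) (Fin (N + 1)) ℝ) (χ : ℝ)
    (δ : Fin N → Fin n → ℝ) (i : Fin N) : relErr a (χ • δ) i = χ • relErr a δ i := by
  simp only [relErr, Finset.smul_sum, Pi.smul_apply]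
  exact Finset.sum_congr rfl fun j _ => smul_comm _ _ _

theorem storageDeriv_smul {N n : ℕ} (Q : Matrix (Fin n) (Fin n) ℝ)
    (a : Matrix (Fin (N + 1)) (Fin (N + 1)) ℝ) (g : Fin N → ℝ) (χ : ℝ) (z z' : ObserverState N n) :
    storageDeriv Q a g z (χ • z') = χ * storageDeriv Q a g z z' := by
  simp only [storageDeriv, Finset.mul_sum, Prod.smul_snd, Prod.smul_fst, relErr_smul,
    Matrix.mulVec_smul, dotProduct_smul, Pi.smul_apply, smul_eq_mul]
  exact Finset.sum_congr rfl fun i _ => by ring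

theorem isSymm_of_posDef {n : ℕ} {Q : Matrix (Fin n) (Fin n) ℝ} (hQ : Q.PosDef) : Qᵀ = Q := by
  simpa using hQ.isHermitian.eq

theorem dotProduct_mulVec_gain {n q : ℕ} {C : Matrix (Fin q) (Fin n) ℝ}
    {Q : Matrix (Fin n) (Fin n) ℝ} (hQ : Q.PosDef) {F : Matrix (Fin n) (Fin q) ℝ}
    (hF : F = -(Q⁻¹ * Cᵀ)) (x y : Fin n → ℝ) :
    x ⬝ᵥ (Q *ᵥ ((F * C) *ᵥ y)) = -((C *ᵥ x) ⬝ᵥ (C *ᵥ y)) := by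
  have hdet := (Matrix.isUnit_iff_isUnit_det _).1 hQ.isUnit
  have h : Q * (F * C) = -(Cᵀ * C) := by
    rw [hF, Matrix.neg_mul, Matrix.mul_neg, Matrix.mul_assoc,
      Matrix.mul_nonsing_inv_cancel_left _ _ hdet]
  rw [Matrix.mulVec_mulVec, h, Matrix.neg_mulVec, dotProduct_neg, ← Matrix.mulVec_mulVec,
    Matrix.dotProduct_mulVec, Matrix.vecMul_transpose]

/-- The linear matrix inequality as a dissipation inequality with a uniform rate. -/
theorem exists_rate_of_lmi {n q : ℕ} {A : Matrix (Fin n) (Fin n) ℝ} {C : Matrix (Fin q) (Fin n) ℝ}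
    {Q : Matrix (Fin n) (Fin n) ℝ} (hQ : Q.PosDef)
    (hLMI : (-(Q * A + Aᵀ * Q - (2 : ℝ) • (Cᵀ * C))).PosDef) :
    ∃ ε : ℝ, 0 < ε ∧ ∀ x : Fin n → ℝ, 2 * (x ⬝ᵥ (Q *ᵥ (A *ᵥ x)))
      ≤ 2 * ((C *ᵥ x) ⬝ᵥ (C *ᵥ x)) - ε * (x ⬝ᵥ (Q *ᵥ x)) := by
  obtain ⟨k, hk, h⟩ := exists_dotProduct_mulVec_le hLMI Q
  refine ⟨k⁻¹, inv_pos.2 hk, fun x => ?_⟩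
  have h1 : x ⬝ᵥ ((-(Q * A + Aᵀ * Q - (2 : ℝ) • (Cᵀ * C))) *ᵥ x)
      = 2 * ((C *ᵥ x) ⬝ᵥ (C *ᵥ x)) - 2 * (x ⬝ᵥ (Q *ᵥ (A *ᵥ x))) := by
    have e1 : x ⬝ᵥ ((Aᵀ * Q) *ᵥ x) = x ⬝ᵥ (Q *ᵥ (A *ᵥ x)) := by
      rw [← Matrix.mulVec_mulVec, Matrix.dotProduct_mulVec, Matrix.vecMul_transpose,
        dotProduct_mulVec_comm_of_isSymm (isSymm_of_posDef hQ)]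
    have e2 : x ⬝ᵥ ((Cᵀ * C) *ᵥ x) = (C *ᵥ x) ⬝ᵥ (C *ᵥ x) := by
      rw [← Matrix.mulVec_mulVec, Matrix.dotProduct_mulVec, Matrix.vecMul_transpose]
    rw [Matrix.neg_mulVec, dotProduct_neg, Matrix.sub_mulVec, dotProduct_sub, Matrix.add_mulVec,
      dotProduct_add, e1, Matrix.smul_mulVec, dotProduct_smul, e2, ← Matrix.mulVec_mulVec,
      smul_eq_mul]
    ring
  have h2 := h x
  rw [h1, ← inv_mul_le_iff₀ hk] at h2
  linarith

theorem observer_error_dissipation {n q : ℕ} {A : Matrix (Fin n) (Fin n) ℝ}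
    {C : Matrix (Fin q) (Fin n) ℝ} {Q : Matrix (Fin n) (Fin n) ℝ} (hQ : Q.PosDef)
    {F : Matrix (Fin n) (Fin q) ℝ} (hF : F = -(Q⁻¹ * Cᵀ)) {ε : ℝ}
    (hε : ∀ x : Fin n → ℝ, 2 * (x ⬝ᵥ (Q *ᵥ (A *ᵥ x)))
      ≤ 2 * ((C *ᵥ x) ⬝ᵥ (C *ᵥ x)) - ε * (x ⬝ᵥ (Q *ᵥ x))) (x : Fin n → ℝ) :
    2 * (x ⬝ᵥ (Q *ᵥ ((A + F * C) *ᵥ x))) ≤ -ε * (x ⬝ᵥ (Q *ᵥ x)) := by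
  rw [Matrix.add_mulVec, Matrix.mulVec_add, dotProduct_add, dotProduct_mulVec_gain hQ hF]
  linarith [hε x]

theorem tendsto_zero_of_observer_error {n q : ℕ} {A : Matrix (Fin n) (Fin n) ℝ}
    {C : Matrix (Fin q) (Fin n) ℝ} {Q : Matrix (Fin n) (Fin n) ℝ} (hQ : Q.PosDef)
    (hLMI : (-(Q * A + Aᵀ * Q - (2 : ℝ) • (Cᵀ * C))).PosDef)
    {F : Matrix (Fin n) (Fin q) ℝ} (hF : F = -(Q⁻¹ * Cᵀ)) {e : ℝ → Fin n → ℝ}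
    (he : ∀ᶠ t in atTop, HasDerivAt e ((A + F * C) *ᵥ e t) t) : Tendsto e atTop (𝓝 0) := by
  obtain ⟨ε, hε0, hε⟩ := exists_rate_of_lmi hQ hLMI
  refine tendsto_zero_of_tendsto_quadForm hQ ?_
  refine tendsto_zero_of_deriv_le_neg_mul_add (r := fun _ => 0) hε0
    (Eventually.of_forall fun t => posDef_dotProduct_nonneg hQ _)
    (he.mono fun t ht => hasDerivAt_quadForm (isSymm_of_posDef hQ) ht)
    (Eventually.of_forall fun t => ?_) tendsto_const_nhds
  rw [add_zero]
  exact observer_error_dissipation hQ hF hε _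

theorem relErr_observerField {N n q : ℕ} (A : Matrix (Fin n) (Fin n) ℝ)
    (C : Matrix (Fin q) (Fin n) ℝ) (F : Matrix (Fin n) (Fin q) ℝ) (Q : Matrix (Fin n) (Fin n) ℝ)
    (a : Matrix (Fin (N + 1)) (Fin (N + 1)) ℝ) (z : ObserverState N n) (i : Fin N) :
    relErr a (observerField A C F Q a z).2.1 i = A *ᵥ relErr a z.2.1 i
      + ∑ j, followerLaplacian a i j • ((z.2.2 j + errEnergy Q a z.2.1 j)
        • ((F * C) *ᵥ relErr a z.2.1 j)) + a i.succ 0 • ((F * C) *ᵥ z.1) := by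
  have h1 : A *ᵥ relErr a z.2.1 i = ∑ j, followerLaplacian a i j • (A *ᵥ z.2.1 j) := by
    simp only [relErr, Matrix.mulVec_sum, Matrix.mulVec_smul]
  rw [h1, ← sum_followerLaplacian a i, Finset.sum_smul, ← Finset.sum_add_distrib,
    ← Finset.sum_add_distrib, relErr]
  exact Finset.sum_congr rfl fun j _ => by simp only [observerField, smul_add]

theorem errEnergy_deriv {N n q : ℕ} {A : Matrix (Fin n) (Fin n) ℝ}
    {C : Matrix (Fin q) (Fin n) ℝ} {Q : Matrix (Fin n) (Fin n) ℝ} (hQ : Q.PosDef)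
    {F : Matrix (Fin n) (Fin q) ℝ} (hF : F = -(Q⁻¹ * Cᵀ))
    (a : Matrix (Fin (N + 1)) (Fin (N + 1)) ℝ) (z : ObserverState N n) (i : Fin N) :
    relErr a z.2.1 i ⬝ᵥ (Q *ᵥ relErr a (observerField A C F Q a z).2.1 i)
      = relErr a z.2.1 i ⬝ᵥ (Q *ᵥ (A *ᵥ relErr a z.2.1 i))
        - ∑ j, followerLaplacian a i j * ((z.2.2 j + errEnergy Q a z.2.1 j)
          * ((C *ᵥ relErr a z.2.1 i) ⬝ᵥ (C *ᵥ relErr a z.2.1 j)))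
        - a i.succ 0 * ((C *ᵥ relErr a z.2.1 i) ⬝ᵥ (C *ᵥ z.1)) := by
  rw [relErr_observerField, Matrix.mulVec_add, Matrix.mulVec_add, dotProduct_add, dotProduct_add,
    Matrix.mulVec_smul, dotProduct_smul, dotProduct_mulVec_gain hQ hF, Matrix.mulVec_sum,
    dotProduct_sum]
  simp only [Matrix.mulVec_smul, dotProduct_smul, dotProduct_mulVec_gain hQ hF, smul_eq_mul,
    mul_neg, Finset.sum_neg_distrib]
  ring

/-- The weights of `exists_weights_followerLaplacian` act coordinatewise on vectors. -/
theorem weights_followerLaplacian_dotProduct {N q : ℕ}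
    {L : Matrix (Fin N) (Fin N) ℝ} {g l : Fin N → ℝ}
    (h : ∀ y : Fin N → ℝ, ∑ i, l i * y i ^ 2 ≤ 2 * ∑ i, ∑ j, g i * L i j * (y i * y j))
    (s : Fin N → ℝ) (z : Fin N → Fin q → ℝ) :
    ∑ i, l i * (s i ^ 2 * (z i ⬝ᵥ z i))
      ≤ 2 * ∑ i, g i * (s i * ∑ j, L i j * (s j * (z i ⬝ᵥ z j))) := by
  have h1 := Finset.sum_le_sum fun k (_ : k ∈ Finset.univ) => h fun i => s i * z i k
  rw [← Finset.mul_sum, Finset.sum_comm] at h1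
  refine (le_of_eq ?_).trans (h1.trans (le_of_eq ?_))
  · refine Finset.sum_congr rfl fun i _ => ?_
    simp only [dotProduct, Finset.mul_sum]
    exact Finset.sum_congr rfl fun k _ => by ring
  · congr 1
    rw [Finset.sum_comm]
    refine Finset.sum_congr rfl fun i _ => ?_
    rw [Finset.sum_comm]
    simp only [dotProduct, Finset.mul_sum]
    exact Finset.sum_congr rfl fun j _ => Finset.sum_congr rfl fun k _ => by ring

theorem two_mul_dotProduct_le {q : ℕ} {l : ℝ} (hl : 0 < l) (τ : ℝ) (x y : Fin q → ℝ) :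
    -(2 * (τ * (x ⬝ᵥ y))) ≤ l * (x ⬝ᵥ x) + τ ^ 2 / l * (y ⬝ᵥ y) := by
  simp only [dotProduct, Finset.mul_sum]
  rw [← Finset.sum_neg_distrib, ← Finset.sum_add_distrib]
  refine Finset.sum_le_sum fun k _ => ?_
  have h : l * (x k * x k) + τ ^ 2 / l * (y k * y k) + 2 * (τ * (x k * y k))
      = (l * x k + τ * y k) ^ 2 / l := by
    field_simp
    ring
  have : 0 ≤ (l * x k + τ * y k) ^ 2 / l := by positivity
  linarith

/-- The dissipation inequality behind both the boundedness and the convergence of the errors.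
Writing `ζ_i = |C ϱ_i|²` for the derivative of `c_i` and `s_i = c_i + ρ_i`, diagonal stability of
the Laplacian supplies the negative terms `-s_i² ζ_i`, which absorb all terms in `s_i ζ_i` up to a
multiple of `ζ_i`. The coupling to the leader's observer error is absorbed by the decay of its own
energy. -/
theorem exists_dissipation {N n q : ℕ} {A : Matrix (Fin n) (Fin n) ℝ}
    {C : Matrix (Fin q) (Fin n) ℝ} {Q : Matrix (Fin n) (Fin n) ℝ} (hQ : Q.PosDef)
    (hLMI : (-(Q * A + Aᵀ * Q - (2 : ℝ) • (Cᵀ * C))).PosDef)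
    {F : Matrix (Fin n) (Fin q) ℝ} (hF : F = -(Q⁻¹ * Cᵀ))
    {a : Matrix (Fin (N + 1)) (Fin (N + 1)) ℝ}
    (ha : IsLeaderFollowerAdjacency a) (htree : HasSpanningTreeRootedAtLeader a) :
    ∃ (g k α : Fin N → ℝ) (κ ε : ℝ), (∀ i, 0 < g i) ∧ 0 < κ ∧ 0 < ε ∧
      ∀ z : ObserverState N n, (∀ i, 0 ≤ z.2.2 i) →
        storageDeriv Q a g z (observerField A C F Q a z)
            + κ * (2 * (z.1 ⬝ᵥ (Q *ᵥ (observerField A C F Q a z).1)))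
          ≤ -ε * storage Q a g z + ∑ i, k i * (observerField A C F Q a z).2.2 i ∧
        storageDeriv Q a g z (observerField A C F Q a z)
            + κ * (2 * (z.1 ⬝ᵥ (Q *ᵥ (observerField A C F Q a z).1)))
            + ∑ i, (z.2.2 i - α i) * (observerField A C F Q a z).2.2 i ≤ 0 := by
  obtain ⟨g, l, hg, hl, hgl⟩ := exists_weights_followerLaplacian ha htree
  obtain ⟨ε, hε0, hε⟩ := exists_rate_of_lmi hQ hLMI
  obtain ⟨m, hm0, hm⟩ := exists_dotProduct_mulVec_le hQ (Cᵀ * C)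
  set K : ℝ := ∑ i, (g i * a i.succ 0) ^ 2 / (l i / 2) with hK
  have hK0 : 0 ≤ K := Finset.sum_nonneg fun i _ => by
    have := hl i
    positivity
  -- `k_i` comes from `3 g s ≤ l s² / 4 + 9 g² / l`, the extra `1 / l` in `α_i` from
  -- `c ≤ l c² / 4 + 1 / l`, and `κ` makes the decay of `e₀ᵀ Q e₀` dominate the coupling
  -- `K |C e₀|²`; its summand `1` keeps it positive.
  refine ⟨g, fun i => 9 * g i ^ 2 / l i, fun i => 9 * g i ^ 2 / l i + 1 / l i, K * m / ε + 1, ε,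
    hg, by positivity, hε0, fun z hc => ?_⟩
  set ϱ := relErr a z.2.1 with hϱ
  set r := errEnergy Q a z.2.1 with hr
  have hr0 : ∀ i, 0 ≤ r i := errEnergy_nonneg hQ a z.2.1
  set ζ : Fin N → ℝ := fun i => (C *ᵥ ϱ i) ⬝ᵥ (C *ᵥ ϱ i) with hζ
  have hζ0 : ∀ i, 0 ≤ ζ i := fun i => by
    simp only [hζ, dotProduct]
    exact Finset.sum_nonneg fun k _ => mul_self_nonneg _
  set μ : ℝ := (C *ᵥ z.1) ⬝ᵥ (C *ᵥ z.1) with hμ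
  have hfc : ∀ i, (observerField A C F Q a z).2.2 i = ζ i := fun i => rfl
  have hfe : (observerField A C F Q a z).1 = (A + F * C) *ᵥ z.1 := rfl
  set s : Fin N → ℝ := fun i => z.2.2 i + r i with hs
  have hs0 : ∀ i, 0 ≤ s i := fun i => add_nonneg (hc i) (hr0 i)
  have hE := observer_error_dissipation hQ hF hε z.1
  have hE0 := posDef_dotProduct_nonneg hQ z.1
  have hμE : μ ≤ m * (z.1 ⬝ᵥ (Q *ᵥ z.1)) := by
    refine le_trans (le_of_eq ?_) (hm z.1)
    rw [← Matrix.mulVec_mulVec, Matrix.dotProduct_mulVec, Matrix.vecMul_transpose]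
  set X : Fin N → ℝ := fun i => ∑ j, followerLaplacian a i j * (s j * ((C *ᵥ ϱ i) ⬝ᵥ (C *ᵥ ϱ j)))
    with hX
  have hlap : ∑ i, l i * (s i ^ 2 * ζ i) ≤ 2 * ∑ i, g i * (s i * X i) :=
    weights_followerLaplacian_dotProduct hgl s fun i => C *ᵥ ϱ i
  have hterm : ∀ i, g i * ((observerField A C F Q a z).2.2 i * r i + s i
      * (2 * (ϱ i ⬝ᵥ (Q *ᵥ relErr a (observerField A C F Q a z).2.1 i))))
      ≤ l i * (s i ^ 2 * ζ i) - 2 * (g i * (s i * X i)) - ε * (g i * (s i * r i))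
        + (9 * g i ^ 2 / l i - l i / 4 * s i ^ 2) * ζ i
        + (g i * a i.succ 0) ^ 2 / (l i / 2) * μ := by
    intro i
    rw [errEnergy_deriv hQ hF, hfc]
    have hli := hl i
    have hgs : 0 ≤ g i * s i := mul_nonneg (hg i).le (hs0 i)
    have h1 := mul_le_mul_of_nonneg_left (hε (ϱ i)) hgs
    have h2 := two_mul_dotProduct_le (half_pos hli) (g i * a i.succ 0) (s i • (C *ᵥ ϱ i))
      (C *ᵥ z.1)
    simp only [smul_dotProduct, dotProduct_smul, smul_eq_mul] at h2
    have h3 : 3 * (g i * s i) * ζ i ≤ (l i / 4 * s i ^ 2 + 9 * g i ^ 2 / l i) * ζ i := by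
      refine mul_le_mul_of_nonneg_right ?_ (hζ0 i)
      have h4 : l i / 4 * s i ^ 2 + 9 * g i ^ 2 / l i - 3 * (g i * s i)
          = (l i * s i - 6 * g i) ^ 2 / (4 * l i) := by
        field_simp
        ring
      have : 0 ≤ (l i * s i - 6 * g i) ^ 2 / (4 * l i) := by positivity
      linarith
    have h5 : g i * (r i * ζ i) ≤ g i * (s i * ζ i) :=
      mul_le_mul_of_nonneg_left (mul_le_mul_of_nonneg_right (by simp only [hs]; linarith [hc i])
        (hζ0 i)) (hg i).le
    have hrdef : r i = ϱ i ⬝ᵥ (Q *ᵥ ϱ i) := rfl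
    have hζdef : ζ i = (C *ᵥ ϱ i) ⬝ᵥ (C *ᵥ ϱ i) := rfl
    have hXdef : X i = ∑ j, followerLaplacian a i j
      * ((z.2.2 j + r j) * ((C *ᵥ ϱ i) ⬝ᵥ (C *ᵥ ϱ j))) := rfl
    rw [← hXdef]
    rw [← hrdef, ← hζdef] at h1
    rw [← hζdef, ← hμ] at h2
    nlinarith [h1, h2, h3, h5]
  have hsum := Finset.sum_le_sum fun i (_ : i ∈ Finset.univ) => hterm i
  simp only [Finset.sum_add_distrib, Finset.sum_sub_distrib, ← Finset.mul_sum,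
    ← Finset.sum_mul] at hsum
  rw [← hK] at hsum
  have hcouple : K * μ + (K * m / ε + 1) * (2 * (z.1 ⬝ᵥ (Q *ᵥ (observerField A C F Q a z).1)))
      ≤ 0 := by
    rw [hfe]
    have h1 := mul_le_mul_of_nonneg_left hE (by positivity : 0 ≤ K * m / ε + 1)
    have h2 := mul_le_mul_of_nonneg_left hμE hK0
    have h3 : (K * m / ε + 1) * (-ε * (z.1 ⬝ᵥ (Q *ᵥ z.1)))
        = -(K * (m * (z.1 ⬝ᵥ (Q *ᵥ z.1)))) - ε * (z.1 ⬝ᵥ (Q *ᵥ z.1)) := by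
      field_simp
      ring
    have h4 := mul_nonneg hε0.le hE0
    linarith
  have hstor : storageDeriv Q a g z (observerField A C F Q a z)
      + (K * m / ε + 1) * (2 * (z.1 ⬝ᵥ (Q *ᵥ (observerField A C F Q a z).1)))
      ≤ -(ε * ∑ i, g i * (s i * r i)) + ∑ i, (9 * g i ^ 2 / l i - l i / 4 * s i ^ 2) * ζ i := by
    have : storageDeriv Q a g z (observerField A C F Q a z) = ∑ i, g i *
      ((observerField A C F Q a z).2.2 i * r i + s i
      * (2 * (ϱ i ⬝ᵥ (Q *ᵥ relErr a (observerField A C F Q a z).2.1 i)))) := rfl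
    linarith
  constructor
  · have h1 : storage Q a g z ≤ ∑ i, g i * (s i * r i) := by
      refine Finset.sum_le_sum fun i _ => mul_le_mul_of_nonneg_left ?_ (hg i).le
      simp only [hs]
      rw [← hr]
      nlinarith [sq_nonneg (r i)]
    have h2 := mul_le_mul_of_nonneg_left h1 hε0.le
    have h3 : ∑ i, (9 * g i ^ 2 / l i - l i / 4 * s i ^ 2) * ζ i
        ≤ ∑ i, 9 * g i ^ 2 / l i * ζ i := by
      refine Finset.sum_le_sum fun i _ => mul_le_mul_of_nonneg_right ?_ (hζ0 i)
      have := hl i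
      have : 0 ≤ l i / 4 * s i ^ 2 := by positivity
      linarith
    simp only [hfc]
    linarith
  · have h1 : 0 ≤ ε * ∑ i, g i * (s i * r i) := mul_nonneg hε0.le
      (Finset.sum_nonneg fun i _ => mul_nonneg (hg i).le (mul_nonneg (hs0 i) (hr0 i)))
    have h2 : ∑ i, (9 * g i ^ 2 / l i - l i / 4 * s i ^ 2) * ζ i
        + ∑ i, (z.2.2 i - (9 * g i ^ 2 / l i + 1 / l i)) * ζ i ≤ 0 := by
      rw [← Finset.sum_add_distrib]
      refine Finset.sum_nonpos fun i _ => ?_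
      rw [← add_mul]
      refine mul_nonpos_of_nonpos_of_nonneg ?_ (hζ0 i)
      have hli := hl i
      have h3 : z.2.2 i ^ 2 ≤ s i ^ 2 :=
        pow_le_pow_left₀ (hc i) (by simp only [hs]; linarith [hr0 i]) 2
      have h4 := mul_le_mul_of_nonneg_left h3 (by positivity : 0 ≤ l i / 4)
      have h5 : l i / 4 * z.2.2 i ^ 2 - z.2.2 i + 1 / l i
          = (l i * z.2.2 i - 2) ^ 2 / (4 * l i) := by
        field_simp
        ring
      have : 0 ≤ (l i * z.2.2 i - 2) ^ 2 / (4 * l i) := by positivity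
      linarith
    simp only [hfc]
    linarith

/-! ### Boundedness and convergence of the observer errors -/

theorem hasDerivAt_fst_and_snd {E F : Type*} [NormedAddCommGroup E] [NormedSpace ℝ E]
    [NormedAddCommGroup F] [NormedSpace ℝ F] {γ : ℝ → E × F} {γ' : E × F} {t : ℝ}
    (h : HasDerivAt γ γ' t) :
    HasDerivAt (fun t => (γ t).1) γ'.1 t ∧ HasDerivAt (fun t => (γ t).2) γ'.2 t :=
  ⟨(hasFDerivAt_fst (𝕜 := ℝ) (p := γ t)).comp_hasDerivAt t h,
    (hasFDerivAt_snd (𝕜 := ℝ) (p := γ t)).comp_hasDerivAt t h⟩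

theorem hasDerivAt_relErr {N n : ℕ} (a : Matrix (Fin (N + 1)) (Fin (N + 1)) ℝ)
    {δ : ℝ → Fin N → Fin n → ℝ} {δ' : Fin N → Fin n → ℝ} {t : ℝ} (h : HasDerivAt δ δ' t)
    (i : Fin N) : HasDerivAt (fun t => relErr a (δ t) i) (relErr a δ' i) t := by
  simp only [relErr]
  exact HasDerivAt.fun_sum fun j _ => (hasDerivAt_pi.1 h j).fun_const_smul _

theorem hasDerivAt_storage {N n : ℕ} {Q : Matrix (Fin n) (Fin n) ℝ} (hQ : Q.PosDef)
    (a : Matrix (Fin (N + 1)) (Fin (N + 1)) ℝ) (g : Fin N → ℝ) {γ : ℝ → ObserverState N n}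
    {γ' : ObserverState N n} {t : ℝ} (h : HasDerivAt γ γ' t) :
    HasDerivAt (fun t => storage Q a g (γ t)) (storageDeriv Q a g (γ t) γ') t := by
  obtain ⟨_, h2⟩ := hasDerivAt_fst_and_snd h
  obtain ⟨hδ, hc⟩ := hasDerivAt_fst_and_snd h2
  have hr : ∀ i, HasDerivAt (fun t => errEnergy Q a (γ t).2.1 i)
      (2 * (relErr a (γ t).2.1 i ⬝ᵥ (Q *ᵥ relErr a γ'.2.1 i))) t := fun i =>
    hasDerivAt_quadForm (isSymm_of_posDef hQ) (hasDerivAt_relErr a hδ i)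
  have h3 : ∀ i, HasDerivAt (fun t => g i * ((γ t).2.2 i * errEnergy Q a (γ t).2.1 i
      + errEnergy Q a (γ t).2.1 i ^ 2 / 2)) _ t := fun i =>
    (((hasDerivAt_pi.1 hc i).mul (hr i)).add (((hr i).pow 2).div_const 2)).const_mul (g i)
  refine (HasDerivAt.fun_sum fun i (_ : i ∈ Finset.univ) => h3 i).congr_deriv ?_
  refine Finset.sum_congr rfl fun i _ => ?_
  simp only [Nat.cast_ofNat, Nat.add_one_sub_one, pow_one]
  ring

theorem hasDerivAt_lyapunov {N n : ℕ} {Q : Matrix (Fin n) (Fin n) ℝ} (hQ : Q.PosDef)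
    (a : Matrix (Fin (N + 1)) (Fin (N + 1)) ℝ) (g α : Fin N → ℝ) (κ : ℝ)
    {γ : ℝ → ObserverState N n} {γ' : ObserverState N n} {t : ℝ} (h : HasDerivAt γ γ' t) :
    HasDerivAt (fun t => lyapunov Q a g α κ (γ t)) (storageDeriv Q a g (γ t) γ'
      + κ * (2 * ((γ t).1 ⬝ᵥ (Q *ᵥ γ'.1))) + ∑ i, ((γ t).2.2 i - α i) * γ'.2.2 i) t := by
  obtain ⟨h1, h2⟩ := hasDerivAt_fst_and_snd h
  obtain ⟨_, hc⟩ := hasDerivAt_fst_and_snd h2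
  have h3 : ∀ i, HasDerivAt (fun t => ((γ t).2.2 i - α i) ^ 2 / 2)
      (((γ t).2.2 i - α i) * γ'.2.2 i) t := fun i => by
    refine ((((hasDerivAt_pi.1 hc i).sub_const (α i)).pow 2).div_const 2).congr_deriv ?_
    simp only [Nat.cast_ofNat, Nat.add_one_sub_one, pow_one]
    ring
  exact ((hasDerivAt_storage hQ a g h).add
    ((hasDerivAt_quadForm (isSymm_of_posDef hQ) h1).const_mul κ)).add
    (HasDerivAt.fun_sum fun i _ => h3 i)

theorem observerField_coupling_nonneg {N n q : ℕ} (A : Matrix (Fin n) (Fin n) ℝ)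
    (C : Matrix (Fin q) (Fin n) ℝ) (F : Matrix (Fin n) (Fin q) ℝ) (Q : Matrix (Fin n) (Fin n) ℝ)
    (a : Matrix (Fin (N + 1)) (Fin (N + 1)) ℝ) (z : ObserverState N n) (i : Fin N) :
    0 ≤ (observerField A C F Q a z).2.2 i := by
  simp only [observerField, dotProduct]
  exact Finset.sum_nonneg fun _ _ => mul_self_nonneg _

theorem coupling_monotoneOn {N n q : ℕ} {A : Matrix (Fin n) (Fin n) ℝ}
    {C : Matrix (Fin q) (Fin n) ℝ} {Q : Matrix (Fin n) (Fin n) ℝ} {F : Matrix (Fin n) (Fin q) ℝ}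
    {a : Matrix (Fin (N + 1)) (Fin (N + 1)) ℝ} {γ : ℝ → ObserverState N n} {χ : ℝ → ℝ} {t₀ : ℝ}
    (hχ : ∀ t ∈ Ici t₀, 0 ≤ χ t)
    (hγ : ∀ t ∈ Ici t₀, HasDerivAt γ (χ t • observerField A C F Q a (γ t)) t) (i : Fin N) :
    MonotoneOn (fun t => (γ t).2.2 i) (Ici t₀) := by
  have hc : ∀ t ∈ Ici t₀, HasDerivAt (fun t => (γ t).2.2 i)
      (χ t * (observerField A C F Q a (γ t)).2.2 i) t := fun t ht =>
    hasDerivAt_pi.1 (hasDerivAt_fst_and_snd (hasDerivAt_fst_and_snd (hγ t ht)).2).2 i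
  exact monotoneOn_of_hasDerivWithinAt_nonneg (convex_Ici t₀)
    (fun t ht => (hc t ht).continuousAt.continuousWithinAt)
    (fun t ht => (hc t (interior_subset ht)).hasDerivWithinAt)
    (fun t ht => mul_nonneg (hχ t (interior_subset ht)) (observerField_coupling_nonneg ..))

/-- The Lyapunov function decreases along trajectories, also when the vector field is slowed down
by a nonnegative factor `χ`. -/
theorem lyapunov_antitoneOn {N n q : ℕ} {A : Matrix (Fin n) (Fin n) ℝ}
    {C : Matrix (Fin q) (Fin n) ℝ} {Q : Matrix (Fin n) (Fin n) ℝ} (hQ : Q.PosDef)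
    {F : Matrix (Fin n) (Fin q) ℝ} {a : Matrix (Fin (N + 1)) (Fin (N + 1)) ℝ}
    {g α : Fin N → ℝ} {κ : ℝ}
    (hW : ∀ z : ObserverState N n, (∀ i, 0 ≤ z.2.2 i) →
      storageDeriv Q a g z (observerField A C F Q a z)
        + κ * (2 * (z.1 ⬝ᵥ (Q *ᵥ (observerField A C F Q a z).1)))
        + ∑ i, (z.2.2 i - α i) * (observerField A C F Q a z).2.2 i ≤ 0)
    {γ : ℝ → ObserverState N n} {χ : ℝ → ℝ} {t₀ : ℝ} (hχ : ∀ t ∈ Ici t₀, 0 ≤ χ t)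
    (hγ : ∀ t ∈ Ici t₀, HasDerivAt γ (χ t • observerField A C F Q a (γ t)) t)
    (hc : ∀ t ∈ Ici t₀, ∀ i, 0 ≤ (γ t).2.2 i) :
    AntitoneOn (fun t => lyapunov Q a g α κ (γ t)) (Ici t₀) := by
  refine antitoneOn_of_hasDerivWithinAt_nonpos (convex_Ici t₀)
    (fun t ht => (hasDerivAt_lyapunov hQ a g α κ (hγ t ht)).continuousAt.continuousWithinAt)
    (fun t ht =>
      (hasDerivAt_lyapunov hQ a g α κ (hγ t (interior_subset ht))).hasDerivWithinAt)
    (fun t ht => ?_)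
  have ht := interior_subset ht
  have h := mul_nonpos_of_nonneg_of_nonpos (hχ t ht) (hW (γ t) (hc t ht))
  refine le_trans (le_of_eq ?_) h
  rw [storageDeriv_smul]
  simp only [Prod.smul_fst, Prod.smul_snd, Pi.smul_apply, smul_eq_mul, Matrix.mulVec_smul,
    dotProduct_smul, mul_add, Finset.mul_sum]
  congr 1
  · ring
  · exact Finset.sum_congr rfl fun i _ => by ring

theorem relErr_inv {N n : ℕ} {a : Matrix (Fin (N + 1)) (Fin (N + 1)) ℝ}
    (ha : IsLeaderFollowerAdjacency a) (htree : HasSpanningTreeRootedAtLeader a)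
    (δ : Fin N → Fin n → ℝ) (i : Fin N) :
    δ i = ∑ j, (followerLaplacian a)⁻¹ i j • relErr a δ j := by
  have hdet := isUnit_det_followerLaplacian ha htree
  simp only [relErr, Finset.smul_sum, smul_smul]
  rw [Finset.sum_comm]
  simp only [← Finset.sum_smul, ← Matrix.mul_apply, Matrix.nonsing_inv_mul _ hdet]
  simp [Matrix.one_apply]

theorem isBounded_lyapunov_sublevel {N n : ℕ} {Q : Matrix (Fin n) (Fin n) ℝ} (hQ : Q.PosDef)
    {a : Matrix (Fin (N + 1)) (Fin (N + 1)) ℝ} (ha : IsLeaderFollowerAdjacency a)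
    (htree : HasSpanningTreeRootedAtLeader a) {g : Fin N → ℝ} (hg : ∀ i, 0 < g i) {κ : ℝ}
    (hκ : 0 < κ) (α : Fin N → ℝ) (K : ℝ) :
    Bornology.IsBounded
      {z : ObserverState N n | (∀ i, 0 ≤ z.2.2 i) ∧ lyapunov Q a g α κ z ≤ K} := by
  have hparts : ∀ z ∈ {z : ObserverState N n | (∀ i, 0 ≤ z.2.2 i) ∧ lyapunov Q a g α κ z ≤ K},
      κ * (z.1 ⬝ᵥ (Q *ᵥ z.1)) ≤ K ∧ (∀ i, g i * (errEnergy Q a z.2.1 i ^ 2 / 2) ≤ K) ∧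
        ∀ i, (z.2.2 i - α i) ^ 2 / 2 ≤ K := by
    rintro z ⟨hc, hK⟩
    have h1 : ∀ i ∈ Finset.univ, 0 ≤ g i * (z.2.2 i * errEnergy Q a z.2.1 i
        + errEnergy Q a z.2.1 i ^ 2 / 2) := fun i _ => mul_nonneg (hg i).le
      (add_nonneg (mul_nonneg (hc i) (errEnergy_nonneg hQ a z.2.1 i)) (by positivity))
    have h2 : ∀ i ∈ Finset.univ, 0 ≤ (z.2.2 i - α i) ^ 2 / 2 := fun i _ => by positivity
    have h3 := mul_nonneg hκ.le (posDef_dotProduct_nonneg hQ z.1)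
    have h4 := Finset.sum_nonneg h1
    have h5 := Finset.sum_nonneg h2
    simp only [lyapunov, storage] at hK
    refine ⟨by linarith, fun i => ?_, fun i => ?_⟩
    · have h6 := Finset.single_le_sum h1 (Finset.mem_univ i)
      have h7 : g i * (errEnergy Q a z.2.1 i ^ 2 / 2) ≤ g i * (z.2.2 i * errEnergy Q a z.2.1 i
          + errEnergy Q a z.2.1 i ^ 2 / 2) := mul_le_mul_of_nonneg_left
        (le_add_of_nonneg_left (mul_nonneg (hc i) (errEnergy_nonneg hQ a z.2.1 i))) (hg i).le
      linarith
    · have h6 := Finset.single_le_sum h2 (Finset.mem_univ i)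
      linarith
  rw [← Bornology.isBounded_image_fst_and_snd]
  constructor
  · refine Bornology.forall_isBounded_image_eval_iff.1 fun j => ?_
    obtain ⟨k, hk, h⟩ := exists_sq_apply_le hQ j
    refine isBounded_iff_forall_norm_le.2 ⟨√(k * (K / κ)), ?_⟩
    rintro _ ⟨_, ⟨z, hz, rfl⟩, rfl⟩
    refine Real.abs_le_sqrt ((h z.1).trans (mul_le_mul_of_nonneg_left ?_ hk.le))
    rw [le_div_iff₀ hκ, mul_comm]
    exact (hparts z hz).1
  rw [← Bornology.isBounded_image_fst_and_snd]
  constructor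
  · refine Bornology.forall_isBounded_image_eval_iff.1 fun i => ?_
    refine Bornology.forall_isBounded_image_eval_iff.1 fun j => ?_
    obtain ⟨k, hk, h⟩ := exists_sq_apply_le hQ j
    refine isBounded_iff_forall_norm_le.2
      ⟨∑ l, |(followerLaplacian a)⁻¹ i l| * √(k * √(2 * K / g l)), ?_⟩
    rintro _ ⟨_, ⟨_, ⟨_, ⟨z, hz, rfl⟩, rfl⟩, rfl⟩, rfl⟩
    simp only [Function.eval]
    rw [relErr_inv ha htree z.2.1 i, Finset.sum_apply]
    refine (Finset.abs_sum_le_sum_abs _ _).trans (Finset.sum_le_sum fun l _ => ?_)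
    rw [Pi.smul_apply, smul_eq_mul, abs_mul]
    refine mul_le_mul_of_nonneg_left (Real.abs_le_sqrt ((h _).trans
      (mul_le_mul_of_nonneg_left ?_ hk.le))) (abs_nonneg _)
    refine Real.le_sqrt_of_sq_le ?_
    rw [le_div_iff₀ (hg l)]
    have h1 := (hparts z hz).2.1 l
    simp only [errEnergy] at h1
    linarith
  · refine Bornology.forall_isBounded_image_eval_iff.1 fun i => ?_
    refine isBounded_iff_forall_norm_le.2 ⟨√(2 * K) + |α i|, ?_⟩
    rintro _ ⟨_, ⟨_, ⟨z, hz, rfl⟩, rfl⟩, rfl⟩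
    have h1 : |z.2.2 i - α i| ≤ √(2 * K) :=
      Real.abs_le_sqrt (by linarith [(hparts z hz).2.2 i])
    calc |z.2.2 i| = |(z.2.2 i - α i) + α i| := by rw [sub_add_cancel]
      _ ≤ |z.2.2 i - α i| + |α i| := abs_add_le _ _
      _ ≤ _ := by linarith

/-- Along the observer error system the errors vanish and the coupling weights converge. The
weights are monotone and bounded by the Lyapunov function. Their increments, together with the decay
of the leader's error energy, are then convergent inputs that bound the storage through
`tendsto_zero_of_deriv_le_neg_mul_add_deriv`. -/
theorem observer_errors_converge {N n q : ℕ} {A : Matrix (Fin n) (Fin n) ℝ}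
    {C : Matrix (Fin q) (Fin n) ℝ} {Q : Matrix (Fin n) (Fin n) ℝ} (hQ : Q.PosDef)
    (hLMI : (-(Q * A + Aᵀ * Q - (2 : ℝ) • (Cᵀ * C))).PosDef)
    {F : Matrix (Fin n) (Fin q) ℝ} (hF : F = -(Q⁻¹ * Cᵀ))
    {a : Matrix (Fin (N + 1)) (Fin (N + 1)) ℝ}
    (ha : IsLeaderFollowerAdjacency a) (htree : HasSpanningTreeRootedAtLeader a)
    {γ : ℝ → ObserverState N n} {t₀ : ℝ}
    (hγ : ∀ t ∈ Ici t₀, HasDerivAt γ (observerField A C F Q a (γ t)) t)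
    (hc₀ : ∀ i, 0 ≤ (γ t₀).2.2 i) :
    Tendsto (fun t => (γ t).1) atTop (𝓝 0) ∧ Tendsto (fun t => (γ t).2.1) atTop (𝓝 0) ∧
      ∀ i, ∃ cLim : ℝ, Tendsto (fun t => (γ t).2.2 i) atTop (𝓝 cLim) := by
  obtain ⟨g, k, α, κ, ε, hg, hκ, hε, hdiss⟩ := exists_dissipation (N := N) hQ hLMI hF ha htree
  have hγ1 : ∀ t ∈ Ici t₀, HasDerivAt γ ((1 : ℝ) • observerField A C F Q a (γ t)) t := by
    simpa only [one_smul] using hγ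
  have hmono := coupling_monotoneOn (χ := fun _ => 1) (fun _ _ => zero_le_one) hγ1
  have hc : ∀ t ∈ Ici t₀, ∀ i, 0 ≤ (γ t).2.2 i := fun t ht i =>
    (hc₀ i).trans (hmono i self_mem_Ici ht ht)
  have hanti := lyapunov_antitoneOn hQ (χ := fun _ => 1) (fun z hz => (hdiss z hz).2)
    (fun _ _ => zero_le_one) hγ1 hc
  have hbdd := isBounded_lyapunov_sublevel hQ ha htree hg hκ α (lyapunov Q a g α κ (γ t₀))
  obtain ⟨R, hR⟩ := hbdd.exists_norm_le
  have hcR : ∀ t ∈ Ici t₀, ∀ i, (γ t).2.2 i ≤ R := fun t ht i =>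
    (le_abs_self _).trans (((norm_le_pi_norm (γ t).2.2 i).trans (norm_snd_le (γ t).2)).trans
      ((norm_snd_le (γ t)).trans (hR _ ⟨hc t ht, hanti self_mem_Ici ht ht⟩)))
  have hclim : ∀ i, ∃ cLim : ℝ, Tendsto (fun t => (γ t).2.2 i) atTop (𝓝 cLim) := by
    intro i
    have hm : Monotone (fun t => (γ (max t t₀)).2.2 i) := fun s t hst =>
      hmono i (mem_Ici.2 (le_max_right _ _)) (mem_Ici.2 (le_max_right _ _))
        (max_le_max_right t₀ hst)
    have hb : BddAbove (range fun t => (γ (max t t₀)).2.2 i) := by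
      refine ⟨R, ?_⟩
      rintro _ ⟨t, rfl⟩
      exact hcR _ (mem_Ici.2 (le_max_right _ _)) i
    refine ⟨_, (tendsto_atTop_ciSup hm hb).congr' ?_⟩
    filter_upwards [eventually_ge_atTop t₀] with t ht
    rw [max_eq_left ht]
  have hev : ∀ᶠ t in atTop, t ∈ Ici t₀ := eventually_ge_atTop t₀
  have he : Tendsto (fun t => (γ t).1) atTop (𝓝 0) :=
    tendsto_zero_of_observer_error hQ hLMI hF
      (hev.mono fun t ht => (hasDerivAt_fst_and_snd (hγ t ht)).1)
  choose cLim hcLim using hclim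
  have hE : Tendsto (fun t => (γ t).1 ⬝ᵥ (Q *ᵥ (γ t).1)) atTop (𝓝 0) := by
    have h : Continuous fun x : Fin n → ℝ => x ⬝ᵥ (Q *ᵥ x) := by fun_prop
    exact (h.tendsto' 0 0 (by simp)).comp he
  have hst0 : ∀ t ∈ Ici t₀, ∀ i ∈ Finset.univ, 0 ≤ g i * ((γ t).2.2 i * errEnergy Q a (γ t).2.1 i
      + errEnergy Q a (γ t).2.1 i ^ 2 / 2) := fun t ht i _ => mul_nonneg (hg i).le
    (add_nonneg (mul_nonneg (hc t ht i) (errEnergy_nonneg hQ a _ i)) (by positivity))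
  have hst : Tendsto (fun t => storage Q a g (γ t)) atTop (𝓝 0) := by
    refine tendsto_zero_of_deriv_le_neg_mul_add_deriv
      (R := fun t => ∑ i, k i * (γ t).2.2 i - κ * ((γ t).1 ⬝ᵥ (Q *ᵥ (γ t).1)))
      (R' := fun t => ∑ i, k i * (observerField A C F Q a (γ t)).2.2 i
        - κ * (2 * ((γ t).1 ⬝ᵥ (Q *ᵥ (observerField A C F Q a (γ t)).1)))) hε
      (hev.mono fun t ht => Finset.sum_nonneg (hst0 t ht))
      (hev.mono fun t ht => hasDerivAt_storage hQ a g (hγ t ht))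
      (hev.mono fun t ht => ?_) (hev.mono fun t ht => ?_)
      ((tendsto_finsetSum _ fun i _ => (hcLim i).const_mul (k i)).sub (hE.const_mul κ))
    · obtain ⟨h1, h2⟩ := hasDerivAt_fst_and_snd (hγ t ht)
      obtain ⟨_, h4⟩ := hasDerivAt_fst_and_snd h2
      exact (HasDerivAt.fun_sum fun i _ => (hasDerivAt_pi.1 h4 i).const_mul (k i)).sub
        ((hasDerivAt_quadForm (isSymm_of_posDef hQ) h1).const_mul κ)
    · have h := (hdiss (γ t) (hc t ht)).1
      linarith
  have hϱ : ∀ i, Tendsto (fun t => relErr a (γ t).2.1 i) atTop (𝓝 0) := by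
    intro i
    refine tendsto_zero_of_tendsto_quadForm hQ ?_
    have h1 : Tendsto (fun t => √(2 / g i * storage Q a g (γ t))) atTop (𝓝 0) := by
      have h := (Real.continuous_sqrt.tendsto 0).comp (by simpa using hst.const_mul (2 / g i))
      rwa [Real.sqrt_zero] at h
    refine squeeze_zero' (Eventually.of_forall fun t => errEnergy_nonneg hQ a _ i)
      (hev.mono fun t ht => ?_) h1
    refine Real.le_sqrt_of_sq_le ?_
    have h2 := Finset.single_le_sum (hst0 t ht) (Finset.mem_univ i)
    have h3 : g i * (errEnergy Q a (γ t).2.1 i ^ 2 / 2) ≤ storage Q a g (γ t) :=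
      le_trans (mul_le_mul_of_nonneg_left (le_add_of_nonneg_left
        (mul_nonneg (hc t ht i) (errEnergy_nonneg hQ a _ i))) (hg i).le) h2
    have h4 := mul_le_mul_of_nonneg_left h3 (div_nonneg zero_le_two (hg i).le)
    refine le_trans (le_of_eq ?_) h4
    have := (hg i).ne'
    rw [errEnergy]
    field_simp
  refine ⟨he, tendsto_pi_nhds.2 fun i => ?_, fun i => ⟨_, hcLim i⟩⟩
  have h1 := tendsto_finsetSum Finset.univ fun j _ =>
    (hϱ j).const_smul ((followerLaplacian a)⁻¹ i j)
  simp only [smul_zero, Finset.sum_const_zero] at h1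
  exact h1.congr fun t => (relErr_inv ha htree (γ t).2.1 i).symm

/-! ### Global existence for the observer error system -/

theorem contDiff_mulVec {E : Type*} [NormedAddCommGroup E] [NormedSpace ℝ E] {m n : ℕ}
    (M : Matrix (Fin m) (Fin n) ℝ) {f : E → Fin n → ℝ} (hf : ContDiff ℝ 1 f) :
    ContDiff ℝ 1 fun x => M *ᵥ f x := by
  refine contDiff_pi.2 fun i => ?_
  simp only [Matrix.mulVec, dotProduct]
  exact ContDiff.sum fun j _ => contDiff_const.mul (contDiff_pi.1 hf j)

theorem contDiff_dotProduct {E : Type*} [NormedAddCommGroup E] [NormedSpace ℝ E] {n : ℕ}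
    {f g : E → Fin n → ℝ} (hf : ContDiff ℝ 1 f) (hg : ContDiff ℝ 1 g) :
    ContDiff ℝ 1 fun x => f x ⬝ᵥ g x := by
  simp only [dotProduct]
  exact ContDiff.sum fun j _ => (contDiff_pi.1 hf j).mul (contDiff_pi.1 hg j)

theorem contDiff_observerField {N n q : ℕ} (A : Matrix (Fin n) (Fin n) ℝ)
    (C : Matrix (Fin q) (Fin n) ℝ) (F : Matrix (Fin n) (Fin q) ℝ) (Q : Matrix (Fin n) (Fin n) ℝ)
    (a : Matrix (Fin (N + 1)) (Fin (N + 1)) ℝ) :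
    ContDiff ℝ 1 (observerField A C F Q a) := by
  have he : ContDiff ℝ 1 fun z : ObserverState N n => z.1 := contDiff_fst
  have hδ : ∀ i, ContDiff ℝ 1 fun z : ObserverState N n => z.2.1 i :=
    contDiff_pi.1 (contDiff_fst.comp contDiff_snd)
  have hc : ∀ i, ContDiff ℝ 1 fun z : ObserverState N n => z.2.2 i :=
    contDiff_pi.1 (contDiff_snd.comp contDiff_snd)
  have hϱ : ∀ i, ContDiff ℝ 1 fun z : ObserverState N n => relErr a z.2.1 i := fun i => by
    simp only [relErr]
    exact ContDiff.sum fun j _ => contDiff_const.fun_smul (hδ j)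
  refine (contDiff_mulVec _ he).prodMk (ContDiff.prodMk (contDiff_pi.2 fun i => ?_)
    (contDiff_pi.2 fun i => ?_))
  · exact ((contDiff_mulVec _ (hδ i)).add (((hc i).add
      (contDiff_dotProduct (hϱ i) (contDiff_mulVec _ (hϱ i)))).smul
      (contDiff_mulVec _ (hϱ i)))).add (contDiff_mulVec _ he)
  · exact contDiff_dotProduct (contDiff_mulVec _ (hϱ i)) (contDiff_mulVec _ (hϱ i))

/-- The vector field is multiplied by a cutoff `χ` that is one on a ball containing a sublevel set
of the Lyapunov function. The modified field is complete, and its trajectories stay in that sublevel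
set, where both fields agree. -/
theorem exists_observer_solution {N n q : ℕ} {A : Matrix (Fin n) (Fin n) ℝ}
    {C : Matrix (Fin q) (Fin n) ℝ} {Q : Matrix (Fin n) (Fin n) ℝ} (hQ : Q.PosDef)
    (hLMI : (-(Q * A + Aᵀ * Q - (2 : ℝ) • (Cᵀ * C))).PosDef)
    {F : Matrix (Fin n) (Fin q) ℝ} (hF : F = -(Q⁻¹ * Cᵀ))
    {a : Matrix (Fin (N + 1)) (Fin (N + 1)) ℝ}
    (ha : IsLeaderFollowerAdjacency a) (htree : HasSpanningTreeRootedAtLeader a)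
    (z₀ : ObserverState N n) (hc₀ : ∀ i, 0 ≤ z₀.2.2 i) :
    ∃ γ : ℝ → ObserverState N n, γ 0 = z₀ ∧
      ∀ t ∈ Ici (0 : ℝ), HasDerivAt γ (observerField A C F Q a (γ t)) t := by
  obtain ⟨g, k, α, κ, ε, hg, hκ, hε, hdiss⟩ := exists_dissipation (N := N) hQ hLMI hF ha htree
  obtain ⟨R, hR0, hR⟩ := (isBounded_lyapunov_sublevel hQ ha htree hg hκ α
    (lyapunov Q a g α κ z₀)).exists_pos_norm_le
  let χ : ContDiffBump (0 : ObserverState N n) :=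
    { rIn := R, rOut := R + 1, rIn_pos := hR0, rIn_lt_rOut := by linarith }
  set f := observerField (N := N) A C F Q a with hf
  have hsmooth : ContDiff ℝ 1 fun z => χ z • f z :=
    χ.contDiff.smul (contDiff_observerField A C F Q a)
  have hsupp : HasCompactSupport fun z => χ z • f z := χ.hasCompactSupport.smul_right
  obtain ⟨K, hK⟩ := ContDiff.lipschitzWith_of_hasCompactSupport hsupp hsmooth one_ne_zero
  obtain ⟨L, hL⟩ := hsupp.exists_bound_of_continuous hsmooth.continuous
  obtain ⟨γ, hγ0, hγ⟩ := exists_global_integralCurve (L := L.toNNReal) hK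
    (fun z => (hL z).trans (Real.le_coe_toNNReal L)) z₀
  refine ⟨γ, hγ0, fun t ht => ?_⟩
  have hχ : ∀ t ∈ Ici (0 : ℝ), 0 ≤ χ (γ t) := fun t _ => χ.nonneg
  have hγ' : ∀ t ∈ Ici (0 : ℝ), HasDerivAt γ (χ (γ t) • f (γ t)) t := fun t _ => hγ t
  have hc : ∀ t ∈ Ici (0 : ℝ), ∀ i, 0 ≤ (γ t).2.2 i := fun t ht i =>
    (hc₀ i).trans (hγ0 ▸ coupling_monotoneOn hχ hγ' i self_mem_Ici ht ht)
  have hanti := lyapunov_antitoneOn hQ (fun z hz => (hdiss z hz).2) hχ hγ' hc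
  have hle : lyapunov Q a g α κ (γ t) ≤ lyapunov Q a g α κ z₀ :=
    hγ0 ▸ hanti self_mem_Ici ht ht
  have hone : χ (γ t) = 1 := χ.one_of_mem_closedBall (by simpa using hR _ ⟨hc t ht, hle⟩)
  simpa [hone] using hγ' t ht

/-! ### Solutions of the closed loop -/

/-- The relative errors of the protocol are those of the observer error system. -/
theorem varrho_eq_relErr {N n : ℕ} (s : Signals N n) (a : Matrix (Fin (N + 1)) (Fin (N + 1)) ℝ)
    (i : Fin N) {t : ℝ} (hv : s.v 0 t = 0) :
    s.varrho a i t = relErr a (fun j => s.v j.succ t - s.w j.succ t + s.w 0 t) i := by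
  have h := sum_followerLaplacian_smul a (fun j => s.v j t - s.w j t) i
  simp only [hv, zero_sub, sub_neg_eq_add] at h
  rw [relErr, h, Signals.varrho, Signals.ψ, Signals.η, ← Finset.sum_sub_distrib]
  refine Finset.sum_congr rfl fun j _ => ?_
  rw [← smul_sub]
  congr 1
  abel

theorem dotProduct_transpose_mul_one_mul {n q : ℕ} (C : Matrix (Fin q) (Fin n) ℝ)
    (x : Fin n → ℝ) :
    x ⬝ᵥ ((Cᵀ * (1 : Matrix (Fin q) (Fin q) ℝ) * C) *ᵥ x) = (C *ᵥ x) ⬝ᵥ (C *ᵥ x) := by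
  rw [Matrix.mul_one, ← Matrix.mulVec_mulVec, Matrix.dotProduct_mulVec, Matrix.vecMul_transpose]

/-- Freezing a function at its initial value for negative times creates no new discontinuity, even
if `0` is an exceptional point. -/
theorem continuousAt_comp_max {E : Type*} [TopologicalSpace E] {f : ℝ → E} {S : Finset ℝ}
    (hf : ∀ t, 0 ≤ t → t ∉ S → ContinuousWithinAt f (Ici 0) t) {t : ℝ} (ht : t ∉ S) :
    ContinuousAt (fun t => f (max t 0)) t := by
  rcases lt_or_ge t 0 with h | h
  · refine ContinuousAt.congr (f := fun _ => f 0) continuousAt_const ?_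
    filter_upwards [Iio_mem_nhds h] with s hs
    rw [max_eq_right (le_of_lt hs)]
  · have h1 : Tendsto (fun t : ℝ => max t 0) (𝓝 t) (𝓝[Ici 0] t) := by
      refine tendsto_nhdsWithin_iff.2 ⟨?_,
        Eventually.of_forall fun s => mem_Ici.2 (le_max_right _ _)⟩
      have h2 : Continuous fun t : ℝ => max t 0 := by fun_prop
      exact h2.tendsto' t t (max_eq_left h)
    have h3 := (hf t h ht).tendsto.comp h1
    rw [ContinuousAt, max_eq_left h]
    exact h3

/-- A follower's state `x` and local observer `w`, driven by the formation shape `h` and by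
`d = v - w`, form a linear system with piecewise continuous input. -/
theorem exists_follower_solution {n p q : ℕ} (A : Matrix (Fin n) (Fin n) ℝ)
    (B : Matrix (Fin n) (Fin p) ℝ) (C : Matrix (Fin q) (Fin n) ℝ) (K₁ K₂ : Matrix (Fin p) (Fin n) ℝ)
    (F : Matrix (Fin n) (Fin q) ℝ) {S : Finset ℝ} {h : ℝ → Fin n → ℝ}
    (hh : ∀ t : ℝ, 0 ≤ t → t ∉ S → HasDerivWithinAt h ((A + B * K₁) *ᵥ h t) (Ici 0) t)
    {d : ℝ → Fin n → ℝ} (hd : ContinuousOn d (Ici 0)) (x₀ w₀ : Fin n → ℝ) :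
    ∃ x w : ℝ → Fin n → ℝ, Continuous x ∧ Continuous w ∧ x 0 = x₀ ∧ w 0 = w₀ ∧
      ∀ t, 0 ≤ t → t ∉ S →
        HasDerivAt x (A *ᵥ x t + B *ᵥ (K₁ *ᵥ h t + K₂ *ᵥ (w t + d t))) t ∧
        HasDerivAt w (A *ᵥ w t + B *ᵥ (K₁ *ᵥ h t + K₂ *ᵥ (w t + d t)) - (B * K₁) *ᵥ h t
          + F *ᵥ (C *ᵥ w t - (C *ᵥ x t - C *ᵥ h t))) t := by
  set L : (Fin n → ℝ) × (Fin n → ℝ) →L[ℝ] (Fin n → ℝ) × (Fin n → ℝ) :=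
    LinearMap.toContinuousLinearMap (LinearMap.prod
      (A.mulVecLin ∘ₗ LinearMap.fst ℝ _ _ + (B * K₂).mulVecLin ∘ₗ LinearMap.snd ℝ _ _)
      ((A + B * K₂ + F * C).mulVecLin ∘ₗ LinearMap.snd ℝ _ _
        - (F * C).mulVecLin ∘ₗ LinearMap.fst ℝ _ _)) with hL
  -- The input depends continuously on `(h, d)`.
  set G : (Fin n → ℝ) × (Fin n → ℝ) → (Fin n → ℝ) × (Fin n → ℝ) := fun y =>
    ((B * K₁) *ᵥ y.1 + (B * K₂) *ᵥ y.2, (B * K₂) *ᵥ y.2 + (F * C) *ᵥ y.1) with hG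
  have hGc : Continuous G := by
    simp only [hG]
    fun_prop
  -- Nothing is known about `h` and `d` at negative times, so they are frozen there.
  set y : ℝ → (Fin n → ℝ) × (Fin n → ℝ) := fun t => (h (max t 0), d (max t 0)) with hy
  have hyc : ∀ t, t ∉ S → ContinuousAt y t := fun t ht =>
    (continuousAt_comp_max (fun t ht0 htS => (hh t ht0 htS).continuousWithinAt) ht).prodMk
      (continuousAt_comp_max (S := S) (fun t ht0 _ => hd t ht0) ht)
  have hbound : ∀ T : ℝ, ∃ D : ℝ, ∀ t ∈ Icc (-T) T, ‖G (y t)‖ ≤ D := by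
    intro T
    obtain ⟨D₁, hD₁⟩ := exists_bound_of_linear_off_finite S hh T
    obtain ⟨D₂, hD₂⟩ := (isCompact_Icc (a := 0) (b := T)).exists_bound_of_continuousOn
      (hd.mono fun t ht => ht.1)
    obtain ⟨D, hD⟩ := (isCompact_closedBall (0 : (Fin n → ℝ) × (Fin n → ℝ))
      (max D₁ D₂)).exists_bound_of_continuousOn hGc.continuousOn
    refine ⟨D, fun t ht => hD _ ?_⟩
    have hT : 0 ≤ T := by linarith [ht.1, ht.2]
    have hmem : max t 0 ∈ Icc 0 T := ⟨le_max_right _ _, max_le ht.2 hT⟩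
    rw [mem_closedBall_zero_iff]
    exact (norm_prod_le_iff).2 ⟨(hD₁ _ hmem).trans (le_max_left _ _),
      (hD₂ _ hmem).trans (le_max_right _ _)⟩
  obtain ⟨ζ, hζc, hζ0, hζ⟩ := exists_solution_linear_with_input L S (g := fun t => G (y t))
    (fun t ht => hGc.continuousAt.comp (hyc t ht)) hbound (x₀, w₀)
  refine ⟨fun t => (ζ t).1, fun t => (ζ t).2, hζc.fst, hζc.snd, congrArg Prod.fst hζ0,
    congrArg Prod.snd hζ0,
    fun t ht htS => ?_⟩
  obtain ⟨h1, h2⟩ := hasDerivAt_fst_and_snd (hζ t htS)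
  have hyt : y t = (h t, d t) := by simp only [hy, max_eq_left ht]
  refine ⟨h1.congr_deriv ?_, h2.congr_deriv ?_⟩
  · rw [hyt]
    simp [hL, hG, Matrix.mulVec_add, ← Matrix.mulVec_mulVec]
    abel
  · rw [hyt]
    simp [hL, hG, Matrix.mulVec_add, Matrix.mulVec_sub, ← Matrix.mulVec_mulVec]
    abel

/-- The observer errors and weights come from `exists_observer_solution`, the leader's signals from
`x₀' = A x₀` and `w₀ = x₀ + e₀`, and the followers' signals from `exists_follower_solution` with
`v_i - w_i = δ_i - w₀`. -/
theorem exists_closedLoopSolution {N n p q : ℕ} {A : Matrix (Fin n) (Fin n) ℝ}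
    {B : Matrix (Fin n) (Fin p) ℝ}
    {C : Matrix (Fin q) (Fin n) ℝ} {Q : Matrix (Fin n) (Fin n) ℝ} (hQ : Q.PosDef)
    (hLMI : (-(Q * A + Aᵀ * Q - (2 : ℝ) • (Cᵀ * C))).PosDef)
    {F : Matrix (Fin n) (Fin q) ℝ} (hF : F = -(Q⁻¹ * Cᵀ))
    {a : Matrix (Fin (N + 1)) (Fin (N + 1)) ℝ}
    (ha : IsLeaderFollowerAdjacency a) (htree : HasSpanningTreeRootedAtLeader a)
    (K₁ K₂ : Matrix (Fin p) (Fin n) ℝ) {S : Finset ℝ} {h : Fin N → ℝ → Fin n → ℝ}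
    (hh : IsFormationShape A B K₁ S h)
    (xInit wInit : Fin (N + 1) → Fin n → ℝ) (vInit : Fin N → Fin n → ℝ) (cInit : Fin N → ℝ)
    (hc : ∀ i, 0 ≤ cInit i) :
    ∃ s : Signals N n, IsClosedLoopSolution A B C a K₁ K₂ F 1 (fun z => z ⬝ᵥ (Q *ᵥ z)) S h s ∧
      s.StartsAt xInit wInit vInit cInit := by
  obtain ⟨γ, hγ0, hγ⟩ := exists_observer_solution hQ hLMI hF ha htree
    (wInit 0 - xInit 0, fun i => vInit i - wInit i.succ + wInit 0, cInit) hc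
  have hγd : ∀ t, 0 ≤ t → HasDerivAt (fun t => (γ t).1) (observerField A C F Q a (γ t)).1 t ∧
      HasDerivAt (fun t => (γ t).2.1) (observerField A C F Q a (γ t)).2.1 t ∧
      HasDerivAt (fun t => (γ t).2.2) (observerField A C F Q a (γ t)).2.2 t := fun t ht =>
    ⟨(hasDerivAt_fst_and_snd (hγ t ht)).1,
      hasDerivAt_fst_and_snd (hasDerivAt_fst_and_snd (hγ t ht)).2⟩
  obtain ⟨x₀, hx₀c, hx₀0, hx₀⟩ := exists_solution_linear_with_input
    (LinearMap.toContinuousLinearMap A.mulVecLin) (g := fun _ => 0) ∅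
    (fun t _ => continuousAt_const) (fun T => ⟨0, by simp⟩) (xInit 0)
  have hx₀' : ∀ t, HasDerivAt x₀ (A *ᵥ x₀ t) t := fun t =>
    (hx₀ t (by simp)).congr_deriv (by simp)
  set w₀ : ℝ → Fin n → ℝ := fun t => x₀ t + (γ t).1 with hw₀
  have hw₀' : ∀ t, 0 ≤ t → HasDerivAt w₀ (A *ᵥ w₀ t + (F * C) *ᵥ (γ t).1) t := fun t ht => by
    refine ((hx₀' t).add (hγd t ht).1).congr_deriv ?_
    simp only [hw₀, observerField, Matrix.mulVec_add, Matrix.add_mulVec]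
    abel
  have hd' : ∀ i : Fin N, ∀ t, 0 ≤ t → HasDerivAt (fun t => (γ t).2.1 i - w₀ t)
      (A *ᵥ ((γ t).2.1 i - w₀ t) + ((γ t).2.2 i + errEnergy Q a (γ t).2.1 i)
        • ((F * C) *ᵥ relErr a (γ t).2.1 i)) t := fun i t ht => by
    refine ((hasDerivAt_pi.1 (hγd t ht).2.1 i).sub (hw₀' t ht)).congr_deriv ?_
    simp only [observerField, Matrix.mulVec_sub]
    abel
  have hfol := fun i : Fin N => exists_follower_solution A B C K₁ K₂ F (hh i)
    (d := fun t => (γ t).2.1 i - w₀ t)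
    (fun t ht => (hd' i t ht).continuousAt.continuousWithinAt) (xInit i.succ) (wInit i.succ)
  choose x w hxc hwc hx0 hw0 hxw using hfol
  set s : Signals N n :=
    { x := Fin.cons x₀ x
      w := Fin.cons w₀ w
      v := Fin.cons (fun _ => 0) fun i t => w i t + ((γ t).2.1 i - w₀ t)
      c := fun i t => (γ t).2.2 i } with hs
  have hδ : ∀ t, (fun j : Fin N => s.v j.succ t - s.w j.succ t + s.w 0 t) = (γ t).2.1 :=
    fun t => by
      funext j
      simp only [hs, Fin.cons_succ, Fin.cons_zero]
      abel
  have hϱ : ∀ i t, s.varrho a i t = relErr a (γ t).2.1 i := fun i t => by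
    rw [varrho_eq_relErr s a i rfl, hδ]
  have hconton : ∀ {f : ℝ → Fin n → ℝ} {f' : ℝ → Fin n → ℝ},
      (∀ t, 0 ≤ t → HasDerivAt f (f' t) t) → ContinuousOn f (Ici 0) :=
    fun hf t ht => (hf t ht).continuousAt.continuousWithinAt
  refine ⟨s, ⟨?_, ?_, ?_, ?_, ?_, ?_, ?_, ?_, ?_, ?_, ?_⟩, ?_, ?_, ?_, ?_⟩
  · exact Fin.cases hx₀c.continuousOn fun i => (hxc i).continuousOn
  · exact Fin.cases (hconton hw₀') fun i => (hwc i).continuousOn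
  · exact Fin.cases continuousOn_const fun i => (hwc i).continuousOn.add (hconton (hd' i))
  · exact fun i t ht =>
      (hasDerivAt_pi.1 (hγd t ht).2.2 i).continuousAt.continuousWithinAt
  · exact fun t _ _ => (hx₀' t).hasDerivWithinAt
  · intro t ht _
    refine (hw₀' t ht).hasDerivWithinAt.congr_deriv ?_
    simp only [hs, hw₀, Fin.cons_zero, Signals.y, Matrix.mulVec_add, ← Matrix.mulVec_mulVec]
    abel_nf
  · exact fun t _ => rfl
  · intro i t ht htS
    exact (hxw i t ht htS).1.hasDerivWithinAt
  · intro i t ht htS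
    exact (hxw i t ht htS).2.hasDerivWithinAt
  · intro i t ht htS
    rw [hϱ]
    refine ((hxw i t ht htS).2.add (hd' i t ht)).hasDerivWithinAt.congr_deriv ?_
    simp only [hs, Fin.cons_succ, Signals.y, Signals.u, Matrix.mulVec_add, errEnergy]
    abel
  · intro i t ht _
    rw [hϱ, dotProduct_transpose_mul_one_mul]
    exact (hasDerivAt_pi.1 (hγd t ht).2.2 i).hasDerivWithinAt
  · exact Fin.cases hx₀0 hx0
  · refine Fin.cases ?_ hw0
    simp [hs, hw₀, hx₀0, hγ0]
  · intro i
    simp [hs, hw₀, hx₀0, hγ0, hw0]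
  · intro i
    simp [hs, hγ0]

/-- From the last switching time on, `(e₀, δ, c)` is a trajectory of the observer error system and
`x_i - h_i - x₀` solves a Hurwitz system whose input `B K₂ (δ_i + e_i - e₀)` vanishes. -/
theorem closedLoopSolution_tracks {N n p q : ℕ} {A : Matrix (Fin n) (Fin n) ℝ}
    {B : Matrix (Fin n) (Fin p) ℝ}
    {C : Matrix (Fin q) (Fin n) ℝ} {Q : Matrix (Fin n) (Fin n) ℝ} (hQ : Q.PosDef)
    (hLMI : (-(Q * A + Aᵀ * Q - (2 : ℝ) • (Cᵀ * C))).PosDef)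
    {F : Matrix (Fin n) (Fin q) ℝ} (hF : F = -(Q⁻¹ * Cᵀ))
    {a : Matrix (Fin (N + 1)) (Fin (N + 1)) ℝ}
    (ha : IsLeaderFollowerAdjacency a) (htree : HasSpanningTreeRootedAtLeader a)
    {K₁ K₂ : Matrix (Fin p) (Fin n) ℝ} (hK₂ : IsHurwitz (A + B * K₂))
    {S : Finset ℝ} {h : Fin N → ℝ → Fin n → ℝ}
    (hh : IsFormationShape A B K₁ S h) {s : Signals N n}
    (hs : IsClosedLoopSolution A B C a K₁ K₂ F 1 (fun z => z ⬝ᵥ (Q *ᵥ z)) S h s)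
    (hc : ∀ i, 0 ≤ s.c i 0) :
    s.AchievesOutputTracking C h ∧ ∀ i : Fin N, ∃ cLim : ℝ, Tendsto (s.c i) atTop (𝓝 cLim) := by
  -- After the last switching time all signals are differentiable.
  obtain ⟨M, hM⟩ := S.finite_toSet.bddAbove
  set T := max M 0 + 1 with hT
  have hT0 : ∀ t ∈ Ici T, 0 < t := fun t ht => by
    have := mem_Ici.1 ht
    linarith [le_max_right M 0]
  have hTS : ∀ t ∈ Ici T, t ∉ S := fun t ht htS => by
    have := mem_Ici.1 ht
    linarith [le_max_left M 0, hM htS]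
  have hderiv : ∀ {E : Type} [NormedAddCommGroup E] [NormedSpace ℝ E] {f : ℝ → E} {f' : E} {t : ℝ},
      t ∈ Ici T → HasDerivWithinAt f f' (Ici 0) t → HasDerivAt f f' t :=
    fun ht hf => hf.hasDerivAt (Ici_mem_nhds (hT0 _ ht))
  have hϱ : ∀ i t, 0 ≤ t → s.varrho a i t
      = relErr a (fun j => s.v j.succ t - s.w j.succ t + s.w 0 t) i := fun i t ht =>
    varrho_eq_relErr s a i (hs.leader_v t ht)
  set γ : ℝ → ObserverState N n := fun t =>
    (s.w 0 t - s.x 0 t, fun j => s.v j.succ t - s.w j.succ t + s.w 0 t, fun j => s.c j t) with hγ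
  -- The weights are monotone across the switching times, so they are still nonnegative at `T`.
  have hcT : ∀ i, 0 ≤ (γ T).2.2 i := fun i => by
    have hmono := monotoneOn_of_deriv_nonneg_off_finite S (hs.c_cont i)
      (fun t ht htS => hs.follower_c i t ht htS) (fun t _ => by
        rw [dotProduct_transpose_mul_one_mul]
        exact Finset.sum_nonneg fun _ _ => mul_self_nonneg _)
    exact (hc i).trans (hmono self_mem_Ici (hT0 T self_mem_Ici).le (hT0 T self_mem_Ici).le)
  have hγ' : ∀ t ∈ Ici T, HasDerivAt γ (observerField A C F Q a (γ t)) t := by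
    intro t ht
    have ht0 := (hT0 t ht).le
    have htS := hTS t ht
    have hw0 := hderiv ht (hs.leader_w t ht0 htS)
    refine ((hw0.sub (hderiv ht (hs.leader_x t ht0 htS))).congr_deriv ?_).prodMk
      (HasDerivAt.prodMk (hasDerivAt_pi.2 fun i => ?_) (hasDerivAt_pi.2 fun i => ?_))
    · simp only [hγ, Signals.y, Matrix.mulVec_sub, Matrix.add_mulVec, ← Matrix.mulVec_mulVec]
      abel
    · refine (((hderiv ht (hs.follower_v i t ht0 htS)).sub
        (hderiv ht (hs.follower_w i t ht0 htS))).add hw0).congr_deriv ?_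
      rw [hϱ i t ht0]
      simp only [hγ, Signals.y, errEnergy, Matrix.mulVec_sub, Matrix.mulVec_add,
        ← Matrix.mulVec_mulVec]
      abel
    · refine (hderiv ht (hs.follower_c i t ht0 htS)).congr_deriv ?_
      rw [hϱ i t ht0, dotProduct_transpose_mul_one_mul]
  obtain ⟨he0, hδ, hclim⟩ := observer_errors_converge hQ hLMI hF ha htree hγ' hcT
  refine ⟨fun i => ?_, hclim⟩
  have hev : ∀ᶠ t in atTop, t ∈ Ici T := eventually_ge_atTop T
  have he : Tendsto (fun t => s.w i.succ t - (s.x i.succ t - h i t)) atTop (𝓝 0) := by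
    refine tendsto_zero_of_observer_error hQ hLMI hF (hev.mono fun t ht => ?_)
    have ht0 := (hT0 t ht).le
    have htS := hTS t ht
    refine ((hderiv ht (hs.follower_w i t ht0 htS)).sub ((hderiv ht (hs.follower_x i t ht0 htS)).sub
      (hderiv ht (hh i t ht0 htS)))).congr_deriv ?_
    simp only [Signals.y, Matrix.mulVec_sub, Matrix.add_mulVec, ← Matrix.mulVec_mulVec]
    abel
  have hξ : Tendsto (fun t => s.x i.succ t - h i t - s.x 0 t) atTop (𝓝 0) := by
    refine tendsto_zero_of_isHurwitz hK₂ (r := fun t => (B * K₂) *ᵥ ((γ t).2.1 i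
      + (s.w i.succ t - (s.x i.succ t - h i t)) - (γ t).1)) (hev.mono fun t ht => ?_) ?_
    · have ht0 := (hT0 t ht).le
      have htS := hTS t ht
      refine (((hderiv ht (hs.follower_x i t ht0 htS)).sub (hderiv ht (hh i t ht0 htS))).sub
        (hderiv ht (hs.leader_x t ht0 htS))).congr_deriv ?_
      simp only [hγ, Signals.u, Matrix.mulVec_sub, Matrix.mulVec_add, Matrix.add_mulVec,
        ← Matrix.mulVec_mulVec]
      abel
    · have h1 := ((tendsto_pi_nhds.1 hδ i).add he).sub he0
      simp only [Pi.zero_apply, add_zero, sub_zero] at h1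
      exact tendsto_mulVec_zero _ h1
  have hcont : Continuous fun x : Fin n → ℝ => ‖WithLp.toLp 2 (C *ᵥ x)‖ :=
    ((PiLp.continuous_toLp 2 _).comp (by fun_prop)).norm
  refine ((hcont.tendsto' 0 0 (by simp)).comp hξ).congr fun t => ?_
  simp only [Function.comp, Signals.y, Matrix.mulVec_sub]
  congr 2
  abel

end FormationTracking

theorem mainTheorem2 {N n p q : ℕ}
    (A : Matrix (Fin n) (Fin n) ℝ) (B : Matrix (Fin n) (Fin p) ℝ) (C : Matrix (Fin q) (Fin n) ℝ)
    (hAB : FormationTracking.IsStabilizable A B) (hAC : FormationTracking.IsDetectable A C)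
    (a : Matrix (Fin (N + 1)) (Fin (N + 1)) ℝ)
    (ha : FormationTracking.IsLeaderFollowerAdjacency a)
    (htree : FormationTracking.HasSpanningTreeRootedAtLeader a)
    (K₁ K₂ : Matrix (Fin p) (Fin n) ℝ) (hK₂ : FormationTracking.IsHurwitz (A + B * K₂))
    (Q : Matrix (Fin n) (Fin n) ℝ) (hQ : Q.PosDef)
    (hLMI : (-(Q * A + Aᵀ * Q - (2 : ℝ) • (Cᵀ * C))).PosDef)
    (F : Matrix (Fin n) (Fin q) ℝ) (hF : F = -(Q⁻¹ * Cᵀ))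
    (Γ : Matrix (Fin q) (Fin q) ℝ) (hΓ : Γ = 1)
    (ρ : (Fin n → ℝ) → ℝ) (hρ : ∀ z, ρ z = z ⬝ᵥ (Q *ᵥ z))
    (S : Finset ℝ) (h : Fin N → ℝ → Fin n → ℝ)
    (hh : FormationTracking.IsFormationShape A B K₁ S h)
    (xInit wInit : Fin (N + 1) → Fin n → ℝ) (vInit : Fin N → Fin n → ℝ) (cInit : Fin N → ℝ)
    (hc : ∀ i, 0 ≤ cInit i) :
    (∃ s : FormationTracking.Signals N n,
      FormationTracking.IsClosedLoopSolution A B C a K₁ K₂ F Γ ρ S h s ∧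
        s.StartsAt xInit wInit vInit cInit) ∧
    ∀ s : FormationTracking.Signals N n,
      FormationTracking.IsClosedLoopSolution A B C a K₁ K₂ F Γ ρ S h s →
      s.StartsAt xInit wInit vInit cInit →
        s.AchievesOutputTracking C h ∧
          ∀ i : Fin N, ∃ cLim : ℝ, Filter.Tendsto (s.c i) Filter.atTop (nhds cLim) := by
  obtain rfl : ρ = fun z => z ⬝ᵥ (Q *ᵥ z) := funext hρ
  subst hΓ
  refine ⟨FormationTracking.exists_closedLoopSolution hQ hLMI hF ha htree K₁ K₂ hh xInit wInit
    vInit cInit hc, fun s hs hs0 => ?_⟩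
  exact FormationTracking.closedLoopSolution_tracks hQ hLMI hF ha htree hK₂ hh hs fun i => by
    rw [hs0.2.2.2 i]
    exact hc i
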